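/- Let $X=(X_t)_{t\ge 0}$ be a real-valued L\'evy process on a probability space $(\Omega,\mathcal F,\mathsf P)$, with $X_0=0$ a.s. and every sample path c\`adl\`ag (right-continuous with left limits). Assume that $X$ is an upwards skip-free L\'evy chain: there are $h>0$ and a nonzero finite Borel measure $\lambda$ on $\mathbb R$ with $\lambda(\{0\})=0$ such that $\mathsf E[e^{ipX_t}]=\exp\{t\int(e^{ipx}-1)\lambda(dx)\}$ for all $p\in\mathbb R$, $t\ge 0$ (so $X$ is a compound Poisson process with L\'evy measure $\lambda$), $\mathrm{supp}(\lambda)\subset\mathbb Z_h:=\{hk:k\in\mathbb Z\}$ and $\mathrm{supp}(\lambda|_{(0,\infty)})=\{h\}$. Let $\mathbb Z_h^+:=\mathbb Z_h\cap[0,\infty)$ and let $\psi(\beta):=\int(e^{\beta x}-1)\lambda(dx)$ ($\beta\ge 0$) be the Laplace exponent of $X$, and $\Phi(0)$ the largest root of $\psi$ on $[0,\infty)$. For $x\in\mathbb R$ let $T_x:=\inf\{t\ge 0:X_t\ge x\}\in[0,\infty]$ (with $\inf\emptyset=\infty$), and for $T\in[0,\infty]$ let $\underline X_T:=\inf\{X_s: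 0\le s<\infty,\ s\le T\}\in[-\infty,\infty)$. Let $D_1$ be the depth of the excursion of $X$ below its first maximum $0$, made before the level $h$ is reached: $D_1:=-\inf\{X_s:T_0\le s<T_h\}\in[0,\infty]$ (and $D_1:=+\infty$ on the null event that $T_0=\infty$). Define $$W(x):=1\Big/\prod_{r=1}^{\lfloor x/h\rfloor}\mathsf P\big(D_1\le (r-1)h\big)\qquad(x\ge 0),$$ where the empty product is $1$. **Theorem (The scale function).** The events $\{D_1\le (r-1)h\}$, $r\in\{1,2,\dots\}$, and $\{\underline X_{T_y}\ge -x\}$, $y\in\mathbb Z_h^+$, $x\ge 0$, are measurable with respect to the completion of $\mathcal F$ under $\mathsf P$, and $\mathsf P(D_1\le (r-1)h)>0$ for all $r\ge 1$, so that $W$ is well defined. Moreover: 1. For every $y\in\mathbb Z_h^+$ and $x\ge 0$, $$\mathsf P(\underline X_{T_y}\ge -x)=\frac{W(x)}{W(x+y)}.$$ 2. Up to a multiplicative constant, $W$ is the unique function $[0,\infty)\to[0,\infty)$ that is right-continuous, piecewise continuous (finitely many discontinuities in each bounded interval, with finite one-sided limits everywhere) and of exponential order (bounded by $Ae^{\alpha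 x}$, $x\ge 0$, for some $\alpha,A\ge 0$) and has Laplace transform $$\int_0^\infty e^{-\beta x}\,W(x)\,dx=\frac{e^{\beta h}-1}{\beta h\,\psi(\beta)}\qquad(\beta>\Phi(0)).$$ That is, there is a constant $c\in(0,\infty)$ such that $cW$ has all these properties, and every function $V:[0,\infty)\to[0,\infty)$ with all these properties equals $cW$. -/

import Mathlib

open MeasureTheory ProbabilityTheory Filter Topology
open scoped NNReal ENNReal

namespace SkipFree

/-- The lattice `ℤ_h = {h k : k ∈ ℤ}`. -/
def lattice (h : ℝ) : Set ℝ := Set.range fun k : ℤ => h * (k : ℝ)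

/-- A path `[0, ∞) → ℝ` is càdlàg: right-continuous, with (finite) left limits. -/
def IsCadlag (f : ℝ≥0 → ℝ) : Prop :=
  ∀ t : ℝ≥0, ContinuousWithinAt f (Set.Ici t) t ∧ ∃ l : ℝ, Tendsto f (𝓝[<] t) (𝓝 l)

/-- A real-valued Lévy process with càdlàg sample paths. -/
structure IsLevyProcess {Ω : Type*} [MeasurableSpace Ω] (P : Measure Ω) (X : ℝ≥0 → Ω → ℝ) :
    Prop where
  measurable : ∀ t, Measurable (X t)
  cadlag : ∀ ω, IsCadlag fun t => X t ω
  zero : ∀ᵐ ω ∂P, X 0 ω = 0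
  indep : HasIndepIncrements X P
  stationary : ∀ s t : ℝ≥0, s ≤ t → IdentDistrib (fun ω => X t ω - X s ω) (X (t - s)) P P

/-- `X` is a compound Poisson process with Lévy measure `lam` (that is, `lam = c • σ` with
`c > 0` and `σ` a probability measure which does not charge `0`), without drift. -/
structure IsCompoundPoisson {Ω : Type*} [MeasurableSpace Ω] (P : Measure Ω) (X : ℝ≥0 → Ω → ℝ)
    (lam : Measure ℝ) : Prop extends IsLevyProcess P X where
  finite : IsFiniteMeasure lam
  ne_zero : lam ≠ 0
  no_atom_zero : lam {0} = 0
  charFun_eq : ∀ (t : ℝ≥0) (p : ℝ), charFun (P.map (X t)) p =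
    Complex.exp ((t : ℂ) * ∫ x : ℝ, (Complex.exp (Complex.I * (p : ℂ) * (x : ℂ)) - 1) ∂lam)

/-- `X` is an upwards skip-free Lévy chain with lattice step `h` and Lévy measure `lam`. -/
structure IsUpwardsSkipFree {Ω : Type*} [MeasurableSpace Ω] (P : Measure Ω) (X : ℝ≥0 → Ω → ℝ)
    (lam : Measure ℝ) (h : ℝ) : Prop extends IsCompoundPoisson P X lam where
  h_pos : 0 < h
  support_subset : lam.support ⊆ lattice h
  support_pos : (lam.restrict (Set.Ioi 0)).support = {h}

/-- The Laplace exponent `ψ(β) = ∫ (e^{βx} - 1) λ(dx)`. -/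
noncomputable def laplaceExponent (lam : Measure ℝ) (β : ℝ) : ℝ :=
  ∫ x : ℝ, (Real.exp (β * x) - 1) ∂lam

/-- `Φ(0)`, the largest root of `ψ` on `[0, ∞)`. -/
noncomputable def largestRoot (lam : Measure ℝ) : ℝ :=
  sSup {β : ℝ | 0 ≤ β ∧ laplaceExponent lam β = 0}

/-- `T_x = inf {t ≥ 0 : X_t ≥ x}`, the first entrance time into `[x, ∞)` (possibly infinite). -/
noncomputable def entranceTime {Ω : Type*} (X : ℝ≥0 → Ω → ℝ) (x : ℝ) : Ω → WithTop ℝ≥0 :=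
  hittingAfter X (Set.Ici x) 0

/-- The running infimum `inf {X_s : 0 ≤ s ≤ T}` for a time `T ∈ [0, ∞]`
(the overall infimum if `T = ∞`). -/
noncomputable def runningInf {Ω : Type*} (X : ℝ≥0 → Ω → ℝ) (T : WithTop ℝ≥0) (ω : Ω) : EReal :=
  ⨅ s ∈ {s : ℝ≥0 | (s : WithTop ℝ≥0) ≤ T}, ((X s ω : ℝ) : EReal)

open scoped Classical in
/-- `D_k` (`k ≥ 1`): the depth, in `[0, ∞]`, of the excursion of `X` below the new maximum
`(k - 1) h`, i.e. between the times `T_{(k-1)h}` and `T_{kh}`. It is `+∞` if the level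
`(k - 1) h` is never reached. -/
noncomputable def excursionDepth {Ω : Type*} (X : ℝ≥0 → Ω → ℝ) (h : ℝ) (k : ℕ) (ω : Ω) : EReal :=
  if entranceTime X (((k : ℝ) - 1) * h) ω = ⊤ then ⊤
  else ((((k : ℝ) - 1) * h : ℝ) : EReal) -
    ⨅ s ∈ {s : ℝ≥0 | entranceTime X (((k : ℝ) - 1) * h) ω ≤ (s : WithTop ℝ≥0) ∧
      (s : WithTop ℝ≥0) < entranceTime X ((k : ℝ) * h) ω}, ((X s ω : ℝ) : EReal)

/-- The scale function `W(x) = 1 / ∏_{r=1}^{⌊x/h⌋} P(D_1 ≤ (r-1)h)`, `x ≥ 0`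
(only its values on `[0, ∞)` are meaningful). -/
noncomputable def scaleFunction {Ω : Type*} [MeasurableSpace Ω] (P : Measure Ω)
    (X : ℝ≥0 → Ω → ℝ) (h : ℝ) (x : ℝ) : ℝ :=
  1 / ∏ r ∈ Finset.Icc 1 ⌊x / h⌋₊,
    P.real {ω | excursionDepth X h 1 ω ≤ ((((r : ℝ) - 1) * h : ℝ) : EReal)}

/-- `f` is right-continuous on `[0, ∞)`. -/
def RightContinuous (f : ℝ → ℝ) : Prop :=
  ∀ x : ℝ, 0 ≤ x → ContinuousWithinAt f (Set.Ici x) x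

/-- `f` is piecewise continuous on `[0, ∞)`: on every bounded interval it has finitely many
discontinuities, and its one-sided limits exist (and are finite) everywhere. -/
def PiecewiseContinuous (f : ℝ → ℝ) : Prop :=
  (∀ b : ℝ, {x : ℝ | x ∈ Set.Icc 0 b ∧ ¬ ContinuousWithinAt f (Set.Ici 0) x}.Finite) ∧
  (∀ x : ℝ, 0 ≤ x → ∃ l : ℝ, Tendsto f (𝓝[>] x) (𝓝 l)) ∧
  (∀ x : ℝ, 0 < x → ∃ l : ℝ, Tendsto f (𝓝[<] x) (𝓝 l))

/-- `f` maps `[0, ∞)` to `[0, ∞)` and is of exponential order there. -/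
def ExponentialOrder (f : ℝ → ℝ) : Prop :=
  (∀ x : ℝ, 0 ≤ x → 0 ≤ f x) ∧
  ∃ α A : ℝ, 0 ≤ α ∧ 0 ≤ A ∧ ∀ x : ℝ, 0 ≤ x → f x ≤ A * Real.exp (α * x)

/-- `f : [0, ∞) → [0, ∞)` is right-continuous, piecewise continuous, of exponential order, and
its Laplace transform is (finite and) equal to `(e^{βh} - 1) / (β h ψ(β))` for `β > Φ(0)`. -/
structure IsScaleSolution (lam : Measure ℝ) (h : ℝ) (f : ℝ → ℝ) : Prop where
  rightContinuous : RightContinuous f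
  piecewiseContinuous : PiecewiseContinuous f
  exponentialOrder : ExponentialOrder f
  integrable : ∀ β : ℝ, largestRoot lam < β →
    IntegrableOn (fun x => Real.exp (-β * x) * f x) (Set.Ioi 0)
  laplace : ∀ β : ℝ, largestRoot lam < β →
    ∫ x in Set.Ioi (0 : ℝ), Real.exp (-β * x) * f x =
      (Real.exp (β * h) - 1) / (β * h * laplaceExponent lam β)

end SkipFree

/-! Read in units of `h`, the chain lives on `ℤ` and moves up by one step at rate `p = λ{h}` and
down by `i` steps at rate `b i`, with total rate `c`. Since it goes up one step at a time, the
equation "the generator annihilates `w` on the nonnegative integers, and `w = 0` below zero"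
determines `w (n + 1)` from `w 0, ..., w n`. With `w 0 = 1` this defines `scaleSeq`. As `w` is
harmonic inside `[0, N)` and vanishes below it, optional stopping suggests that the chain started at
`n` leaves `[0, N)` upwards with probability `w n / w N`.

This exit formula is the core of the proof (`nullMeasurableSet_exitsUp_and_probability`). It is
obtained by discretizing time. On a grid of mesh `δ` the increments are i.i.d. with a compound
Poisson law, whose one-step operator differs from the identity plus `δ` times the generator by
`O(δ²)`. So `w` of the stopped walk is a martingale up to `O(δ²)` per step. A geometric test
function shows that the walk is unlikely to stay in `[0, N)` for long. With a horizon tending to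
infinity and a vanishing accumulated error, right-continuity of the lattice-valued paths carries the
discrete exit events over to the continuous ones.

The depth event `D_1 ≤ n h` is the upward exit from `[0, n + 1)` started at `n`, so it has
probability `w n / w (n + 1)`. The product in `W` telescopes to `W x = w ⌊x / h⌋`, and part 1 is the
exit formula again.

For the Laplace transform, the recursion gives the generating function of `w` wherever it converges.
These depth events are nested in `n`, so the ratios `w n / w (n + 1)` increase to a limit `q`.
Dividing the recursion by `w n` shows that `q = e^{-βh}` for some root `β ≥ 0` of `ψ`. Hence `β ≤
Φ(0)`, and the series converges on all of `(Φ(0), ∞)`. Uniqueness holds because an exponential tilt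
turns Laplace transforms into moment generating functions, which determine finite measures by
analytic continuation; right-continuity then upgrades a.e. equality to equality. -/

namespace SkipFree

/-! ### The scale sequence: growth, ratio limit and generating function. -/

section ScaleSequence

/-- The solution of `p w(n+1) + ∑_{i+j=n} b i w(j) = c w(n)` with `w(0) = 1`. -/
noncomputable def scaleSeq (b : ℕ → ℝ) (p c : ℝ) : ℕ → ℝ
  | 0 => 1
  | n + 1 => (c * scaleSeq b p c n -
      ∑ i : Fin (n + 1), b i * scaleSeq b p c (n - i)) / p
  decreasing_by all_goals omega

/-- The weights `b` of the downward jumps, `p` of the upward jump, and the total mass `c`. -/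
structure IsJumpData (b : ℕ → ℝ) (p c : ℝ) : Prop where
  nonneg : ∀ i, 0 ≤ b i
  zero : b 0 = 0
  pos : 0 < p
  hasSum : HasSum b (c - p)

variable {b : ℕ → ℝ} {p c : ℝ}

lemma scaleSeq_zero : scaleSeq b p c 0 = 1 := by rw [scaleSeq]

lemma IsJumpData.scaleSeq_succ (H : IsJumpData b p c) (n : ℕ) :
    p * scaleSeq b p c (n + 1) +
      ∑ i ∈ Finset.range (n + 1), b i * scaleSeq b p c (n - i) = c * scaleSeq b p c n := by
  rw [scaleSeq, Finset.sum_range fun i => b i * scaleSeq b p c (n - i)]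
  have := H.pos.ne'
  field_simp
  ring

lemma IsJumpData.sum_le (H : IsJumpData b p c) (n : ℕ) :
    ∑ i ∈ Finset.range n, b i ≤ c - p :=
  sum_le_hasSum _ (fun i _ => H.nonneg i) H.hasSum

lemma IsJumpData.le_total (H : IsJumpData b p c) : p ≤ c := by
  have := H.sum_le 0
  simp at this
  linarith

/-- If the current value dominates all earlier ones, the convolution term is at most `(c - p) w n`,
and the recursion leaves at least `p w n` for `p w (n + 1)`. Lower bound and domination must be
carried through the same induction. -/
lemma IsJumpData.one_le_and_le_succ (H : IsJumpData b p c) (n : ℕ) :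
    (∀ m ≤ n, 1 ≤ scaleSeq b p c m ∧ scaleSeq b p c m ≤ scaleSeq b p c n) ∧
      scaleSeq b p c n ≤ scaleSeq b p c (n + 1) := by
  have key : ∀ n, (∀ m ≤ n, 1 ≤ scaleSeq b p c m ∧ scaleSeq b p c m ≤ scaleSeq b p c n) →
      scaleSeq b p c n ≤ scaleSeq b p c (n + 1) := by
    intro n hn
    have h1 : ∑ i ∈ Finset.range (n + 1), b i * scaleSeq b p c (n - i) ≤
        (c - p) * scaleSeq b p c n := by
      calc _ ≤ ∑ i ∈ Finset.range (n + 1), b i * scaleSeq b p c n :=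
            Finset.sum_le_sum fun i _ =>
              mul_le_mul_of_nonneg_left (hn _ (Nat.sub_le _ _)).2 (H.nonneg i)
        _ = (∑ i ∈ Finset.range (n + 1), b i) * scaleSeq b p c n := by rw [Finset.sum_mul]
        _ ≤ _ := mul_le_mul_of_nonneg_right (H.sum_le _) (by linarith [(hn n le_rfl).1])
    have h2 := H.scaleSeq_succ n
    refine le_of_mul_le_mul_left ?_ H.pos
    linarith
  have base : ∀ n, ∀ m ≤ n, 1 ≤ scaleSeq b p c m ∧ scaleSeq b p c m ≤ scaleSeq b p c n := by
    intro n
    induction n with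
    | zero => intro m hm; obtain rfl : m = 0 := by omega
              simp [scaleSeq_zero]
    | succ n ih =>
      have := key n ih
      intro m hm
      rcases Nat.lt_or_ge m (n + 1) with h | h
      · have := ih m (by omega)
        exact ⟨this.1, by linarith⟩
      · obtain rfl : m = n + 1 := by omega
        exact ⟨by linarith [(ih n le_rfl).1], le_rfl⟩
  exact ⟨base n, key n (base n)⟩

lemma IsJumpData.scaleSeq_mono (H : IsJumpData b p c) : Monotone (scaleSeq b p c) :=
  monotone_nat_of_le_succ fun n => (H.one_le_and_le_succ n).2

lemma IsJumpData.one_le_scaleSeq (H : IsJumpData b p c) (n : ℕ) : 1 ≤ scaleSeq b p c n :=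
  ((H.one_le_and_le_succ n).1 n le_rfl).1

lemma IsJumpData.scaleSeq_pos (H : IsJumpData b p c) (n : ℕ) : 0 < scaleSeq b p c n :=
  one_pos.trans_le (H.one_le_scaleSeq n)

lemma IsJumpData.scaleSeq_le_pow (H : IsJumpData b p c) (n : ℕ) :
    scaleSeq b p c n ≤ (c / p) ^ n := by
  induction n with
  | zero => simp [scaleSeq_zero]
  | succ n ih =>
    have h1 : 0 ≤ ∑ i ∈ Finset.range (n + 1), b i * scaleSeq b p c (n - i) :=
      Finset.sum_nonneg fun i _ => mul_nonneg (H.nonneg i) (H.scaleSeq_pos _).le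
    have h2 := H.scaleSeq_succ n
    have hc : 0 ≤ c / p := div_nonneg (H.pos.le.trans H.le_total) H.pos.le
    have h3 : scaleSeq b p c (n + 1) ≤ c / p * scaleSeq b p c n := by
      have := H.pos
      rw [div_mul_eq_mul_div, le_div_iff₀ this]
      linarith
    calc _ ≤ _ := h3
      _ ≤ c / p * (c / p) ^ n := mul_le_mul_of_nonneg_left ih hc
      _ = _ := by ring

/-- If the ratios `w(n) / w(n+1)` increase, then their limit `q` solves
`p / q + ∑ b i q^i = c`. -/
lemma IsJumpData.exists_ratio_limit (H : IsJumpData b p c)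
    (hr : Monotone fun n => scaleSeq b p c n / scaleSeq b p c (n + 1)) :
    ∃ q : ℝ, 0 < q ∧ q ≤ 1 ∧
      Tendsto (fun n => scaleSeq b p c n / scaleSeq b p c (n + 1)) atTop (𝓝 q) ∧
      p / q + ∑' i, b i * q ^ i = c := by
  set w := scaleSeq b p c with hw
  have hpos := H.scaleSeq_pos
  have hle1 : ∀ n, w n / w (n + 1) ≤ 1 := fun n =>
    (div_le_one (hpos _)).2 (H.scaleSeq_mono (Nat.le_succ n))
  have hlim := tendsto_atTop_ciSup hr ⟨1, by rintro _ ⟨n, rfl⟩; exact hle1 n⟩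
  set q := ⨆ n, w n / w (n + 1) with hq
  have hq0 : 0 < q := (div_pos (hpos 0) (hpos 1)).trans_le (hr.ge_of_tendsto hlim 0)
  have hq1 : q ≤ 1 := le_of_tendsto' hlim hle1
  refine ⟨q, hq0, hq1, hlim, ?_⟩
  -- The quotient is a product of `i` consecutive ratios, each tending to `q`.
  have hback : ∀ i, Tendsto (fun n => w (n - i) / w n) atTop (𝓝 (q ^ i)) := by
    intro i
    suffices h : Tendsto (fun n => w n / w (n + i)) atTop (𝓝 (q ^ i)) by
      rw [← tendsto_add_atTop_iff_nat i]
      simpa using h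
    induction i with
    | zero => simpa using tendsto_const_nhds.congr fun n => (div_self (hpos n).ne').symm
    | succ i ih =>
      have := ih.mul ((tendsto_add_atTop_iff_nat i).2 hlim)
      rw [pow_succ]
      refine this.congr fun n => ?_
      have := (hpos (n + i)).ne'
      rw [div_mul_div_cancel₀ this]
      rfl
  have hsum : Tendsto (fun n => ∑' i, if i ∈ Finset.range (n + 1) then b i * (w (n - i) / w n)
      else 0) atTop (𝓝 (∑' i, b i * q ^ i)) := by
    -- The summable weights `b` dominate, since monotonicity of `w` keeps `w (n - i) / w n` below
    -- `1`.
    refine tendsto_tsum_of_dominated_convergence (bound := b) H.hasSum.summable ?_ ?_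
    · intro i
      refine ((hback i).const_mul (b i)).congr' ?_
      filter_upwards [eventually_ge_atTop i] with n hn
      rw [if_pos (by simp; omega)]
    · refine Eventually.of_forall fun n i => ?_
      split_ifs with hi
      · rw [Real.norm_of_nonneg (mul_nonneg (H.nonneg i) (div_pos (hpos _) (hpos _)).le)]
        exact mul_le_of_le_one_right (H.nonneg i)
          ((div_le_one (hpos _)).2 (H.scaleSeq_mono (Nat.sub_le _ _)))
      · simpa using H.nonneg i
  have hup : Tendsto (fun n => p * (w n / w (n + 1))⁻¹) atTop (𝓝 (p * q⁻¹)) :=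
    (hlim.inv₀ hq0.ne').const_mul p
  have htot := hup.add hsum
  rw [← div_eq_mul_inv] at htot
  refine tendsto_nhds_unique htot (tendsto_const_nhds.congr fun n => ?_)
  rw [tsum_eq_sum (s := Finset.range (n + 1)) fun i hi => if_neg hi, Finset.sum_congr rfl
    (fun i hi => if_pos hi)]
  have h2 := H.scaleSeq_succ n
  have := (hpos n).ne'
  rw [inv_div, ← mul_div_assoc]
  simp_rw [← mul_div_assoc]
  rw [← Finset.sum_div, ← add_div, eq_div_iff this]
  exact h2.symm

lemma summable_scaleSeq_mul_pow (H : IsJumpData b p c) {q z : ℝ} (hq : 0 < q)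
    (hlim : Tendsto (fun n => scaleSeq b p c n / scaleSeq b p c (n + 1)) atTop (𝓝 q))
    (hz0 : 0 < z) (hzq : z < q) : Summable fun n => scaleSeq b p c n * z ^ n := by
  have hpos := H.scaleSeq_pos
  refine summable_of_ratio_test_tendsto_lt_one (l := z / q) ((div_lt_one hq).2 hzq)
    (Eventually.of_forall fun n => (mul_pos (hpos n) (pow_pos hz0 n)).ne') ?_
  have := (hlim.inv₀ hq.ne').const_mul z
  rw [← div_eq_mul_inv] at this
  refine this.congr fun n => ?_
  rw [Real.norm_of_nonneg (mul_pos (hpos _) (pow_pos hz0 _)).le,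
    Real.norm_of_nonneg (mul_pos (hpos _) (pow_pos hz0 _)).le, inv_div]
  have := (hpos n).ne'
  have := hz0.ne'
  field_simp
  ring

/-- The generating function of the scale sequence. -/
lemma IsJumpData.tsum_scaleSeq (H : IsJumpData b p c) {z : ℝ} (hz0 : 0 < z) (hz1 : z ≤ 1)
    (hs : Summable fun n => scaleSeq b p c n * z ^ n) :
    (∑' n, scaleSeq b p c n * z ^ n) * (p / z + ∑' i, b i * z ^ i - c) = p / z := by
  set w := scaleSeq b p c with hw
  have hb : Summable fun i => b i * z ^ i :=
    Summable.of_nonneg_of_le (fun i => mul_nonneg (H.nonneg i) (pow_nonneg hz0.le i))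
      (fun i => mul_le_of_le_one_right (H.nonneg i) (pow_le_one₀ hz0.le hz1)) H.hasSum.summable
  have hprod := tsum_mul_tsum_eq_tsum_sum_range_of_summable_norm hb.norm hs.norm
  have hconv : Summable fun n => ∑ i ∈ Finset.range (n + 1), b i * z ^ i * (w (n - i) * z ^ (n - i)) :=
    (summable_norm_sum_mul_range_of_summable_norm hb.norm hs.norm).of_norm
  -- The recursion times `z ^ n`; summed over `n`, the convolution becomes a Cauchy product and the
  -- shift loses only the term `w 0 = 1`.
  have hrec : ∀ n, p * (w (n + 1) * z ^ (n + 1)) / z +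
      ∑ i ∈ Finset.range (n + 1), b i * z ^ i * (w (n - i) * z ^ (n - i)) =
      c * (w n * z ^ n) := by
    intro n
    have h1 : ∑ i ∈ Finset.range (n + 1), b i * z ^ i * (w (n - i) * z ^ (n - i)) =
        (∑ i ∈ Finset.range (n + 1), b i * w (n - i)) * z ^ n := by
      rw [Finset.sum_mul]
      refine Finset.sum_congr rfl fun i hi => ?_
      have : z ^ n = z ^ i * z ^ (n - i) := by
        rw [← pow_add]; congr 1; simp at hi; omega
      rw [this]; ring
    rw [h1, ← mul_assoc c, ← H.scaleSeq_succ n, pow_succ]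
    have := hz0.ne'
    field_simp
    rfl
  have hs1 : Summable fun n => w (n + 1) * z ^ (n + 1) := (summable_nat_add_iff 1).2 hs
  have hsplit := hs.tsum_eq_zero_add
  have h3 := tsum_congr (L := .unconditional _) hrec
  rw [((hs1.mul_left p).div_const z).tsum_add hconv, ← hprod, tsum_div_const, tsum_mul_left,
    tsum_mul_left] at h3
  have hw0 : w 0 = 1 := scaleSeq_zero
  rw [hw0] at hsplit
  have h4 : ∑' n, w (n + 1) * z ^ (n + 1) = ∑' n, w n * z ^ n - 1 := by
    rw [hsplit]; simp
  rw [h4] at h3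
  have h5 : p * (∑' n, w n * z ^ n - 1) / z = p / z * (∑' n, w n * z ^ n) - p / z := by ring
  rw [h5] at h3
  linarith

end ScaleSequence

/-! ### Compound Poisson laws and their small-time expansion. -/

section CompoundPoisson

/-- The weights of the Poisson mixture of convolution powers. -/
noncomputable def poissonWeight (lam : Measure ℝ) (t : ℝ) (n : ℕ) : ℝ :=
  Real.exp (-(t * lam.real Set.univ)) * (t ^ n / n.factorial)

lemma poissonWeight_nonneg {lam : Measure ℝ} {t : ℝ} (ht : 0 ≤ t) (n : ℕ) : 0 ≤ poissonWeight lam t n := by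
  unfold poissonWeight; positivity

lemma hasSum_poissonWeight_mul_pow {lam : Measure ℝ} (t : ℝ) (z : ℂ) :
    HasSum (fun n => (poissonWeight lam t n : ℂ) * z ^ n)
      (Complex.exp (t * (z - lam.real Set.univ))) := by
  have h := (NormedSpace.expSeries_div_hasSum_exp ((t : ℂ) * z)).mul_left
    (Complex.exp (-(t * lam.real Set.univ)))
  rw [← Complex.exp_eq_exp_ℂ, ← Complex.exp_add] at h
  convert! h using 1
  · ext n
    simp [poissonWeight, mul_pow]
    ring
  · congr 1; ring

/-- Convolution powers of a measure on `ℝ`. -/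
noncomputable def convPow (lam : Measure ℝ) : ℕ → Measure ℝ
  | 0 => Measure.dirac 0
  | n + 1 => Measure.conv (convPow lam n) lam

variable (lam : Measure ℝ) [IsFiniteMeasure lam]

instance isFiniteMeasure_convPow (n : ℕ) : IsFiniteMeasure (convPow lam n) := by
  induction n with
  | zero => rw [convPow]; infer_instance
  | succ n ih => rw [convPow]; infer_instance

lemma charFun_convPow (n : ℕ) (p : ℝ) : charFun (convPow lam n) p = charFun lam p ^ n := by
  induction n with
  | zero => simp [convPow]
  | succ n ih => rw [convPow, charFun_conv, ih, pow_succ]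

lemma convPow_real_univ (n : ℕ) : (convPow lam n).real Set.univ = lam.real Set.univ ^ n := by
  have := charFun_convPow lam n 0
  rw [charFun_zero, charFun_zero] at this
  exact_mod_cast this

lemma convPow_one : convPow lam 1 = lam := by
  rw [convPow, convPow, Measure.dirac_zero_conv]

/-- The law at time `t` of a compound Poisson process with Lévy measure `lam`. -/
noncomputable def compoundPoissonLaw (lam : Measure ℝ) (t : ℝ) : Measure ℝ :=
  Measure.sum fun n => ENNReal.ofReal (poissonWeight lam t n) • convPow lam n

variable {lam}

lemma summable_poissonWeight_mul_pow {lam : Measure ℝ} {t : ℝ} (ht : 0 ≤ t) :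
    Summable fun n => poissonWeight lam t n * lam.real Set.univ ^ n := by
  have := (hasSum_poissonWeight_mul_pow (lam := lam) t (lam.real Set.univ)).summable.norm
  refine this.congr fun n => ?_
  have := poissonWeight_nonneg (lam := lam) ht n
  have h2 : (0 : ℝ) ≤ lam.real Set.univ := measureReal_nonneg
  simp [abs_of_nonneg this, abs_of_nonneg h2]

lemma norm_integral_convPow_le {E : Type*} [NormedAddCommGroup E] [NormedSpace ℝ E] {g : ℝ → E}
    {B : ℝ} (hB : ∀ x, ‖g x‖ ≤ B) (n : ℕ) :
    ‖∫ x, g x ∂convPow lam n‖ ≤ B * lam.real Set.univ ^ n := by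
  rw [← convPow_real_univ]
  exact norm_integral_le_of_norm_le_const (Eventually.of_forall hB)

lemma integrable_compoundPoissonLaw {E : Type*} [NormedAddCommGroup E] {t : ℝ} (ht : 0 ≤ t)
    {g : ℝ → E} (hg : StronglyMeasurable g) {B : ℝ} (hB : ∀ x, ‖g x‖ ≤ B) :
    Integrable g (compoundPoissonLaw lam t) := by
  refine integrable_sum_measure (fun n => ?_) ?_
  · exact (Integrable.of_bound hg.aestronglyMeasurable B (Eventually.of_forall hB)).smul_measure
      ENNReal.ofReal_ne_top
  · refine Summable.of_nonneg_of_le (fun n => integral_nonneg fun x => norm_nonneg _) (fun n => ?_)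
      ((summable_poissonWeight_mul_pow (lam := lam) ht).mul_left B)
    rw [integral_smul_measure, ENNReal.toReal_ofReal (poissonWeight_nonneg ht n), smul_eq_mul]
    have := (le_abs_self _).trans (norm_integral_convPow_le (lam := lam) (g := fun x => ‖g x‖)
      (by simpa using hB) n)
    calc _ ≤ poissonWeight lam t n * (B * lam.real Set.univ ^ n) :=
          mul_le_mul_of_nonneg_left this (poissonWeight_nonneg ht n)
      _ = _ := by ring

lemma hasSum_integral_compoundPoissonLaw {E : Type*} [NormedAddCommGroup E] [NormedSpace ℝ E]
    {t : ℝ} (ht : 0 ≤ t) {g : ℝ → E} (hg : StronglyMeasurable g) {B : ℝ} (hB : ∀ x, ‖g x‖ ≤ B) :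
    HasSum (fun n => poissonWeight lam t n • ∫ x, g x ∂convPow lam n)
      (∫ x, g x ∂compoundPoissonLaw lam t) := by
  have := hasSum_integral_measure (integrable_compoundPoissonLaw (lam := lam) ht hg hB)
  refine this.congr_fun fun n => ?_
  rw [integral_smul_measure, ENNReal.toReal_ofReal (poissonWeight_nonneg ht n)]

lemma isFiniteMeasure_compoundPoissonLaw {t : ℝ} (ht : 0 ≤ t) :
    IsFiniteMeasure (compoundPoissonLaw lam t) := by
  have := integrable_compoundPoissonLaw (lam := lam) ht (g := fun _ => (1 : ℝ))
    stronglyMeasurable_const (B := 1) (by simp)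
  simpa [integrable_const_iff, isFiniteMeasure_iff] using this

lemma charFun_compoundPoissonLaw {t : ℝ} (ht : 0 ≤ t) (p : ℝ) :
    charFun (compoundPoissonLaw lam t) p =
      Complex.exp (t * (charFun lam p - lam.real Set.univ)) := by
  have h1 := hasSum_integral_compoundPoissonLaw (lam := lam) ht
    (g := fun x : ℝ => Complex.exp (p * x * Complex.I))
    (Measurable.stronglyMeasurable (by fun_prop)) (B := 1) (fun x => by
      rw [← Complex.ofReal_mul, Complex.norm_exp_ofReal_mul_I])
  rw [charFun_apply_real]
  refine h1.unique ?_
  convert! hasSum_poissonWeight_mul_pow (lam := lam) t (charFun lam p) using 2 with n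
  rw [← charFun_convPow, charFun_apply_real, Complex.real_smul]

/-- Characteristic functions determine finite measures. This replaces the hypothesis on `charFun` by
an explicit Poisson mixture, which can be expanded at small times. -/
lemma eq_compoundPoissonLaw {μ : Measure ℝ} [IsFiniteMeasure μ] {t : ℝ} (ht : 0 ≤ t)
    (hμ : ∀ p : ℝ, charFun μ p = Complex.exp ((t : ℂ) *
      ∫ x : ℝ, (Complex.exp (Complex.I * (p : ℂ) * (x : ℂ)) - 1) ∂lam)) :
    μ = compoundPoissonLaw lam t := by
  have := isFiniteMeasure_compoundPoissonLaw (lam := lam) ht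
  refine Measure.ext_of_charFun (funext fun p => ?_)
  rw [hμ, charFun_compoundPoissonLaw ht, integral_sub, charFun_apply_real]
  · congr 3
    · congr with x; congr 1; ring
    · simp
  · refine Integrable.of_bound (Measurable.aestronglyMeasurable (by fun_prop)) 1
      (Eventually.of_forall fun x => ?_)
    rw [mul_assoc, mul_comm, ← Complex.ofReal_mul, Complex.norm_exp_ofReal_mul_I]
  · exact integrable_const _

/-- The generator of a compound Poisson process, with a quadratic error bound. -/
lemma abs_integral_compoundPoissonLaw_sub_le {t : ℝ} (ht : 0 ≤ t)
    (ht1 : t * lam.real Set.univ ≤ 1) {g : ℝ → ℝ} (hg : Measurable g) {B : ℝ}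
    (hB : ∀ x, |g x| ≤ B) :
    |∫ x, g x ∂compoundPoissonLaw lam t - g 0 - t * ∫ x, (g x - g 0) ∂lam| ≤
      3 * B * (t * lam.real Set.univ) ^ 2 := by
  set L := lam.real Set.univ with hL
  have hL0 : 0 ≤ L := measureReal_nonneg
  set x := t * L with hx
  have hx0 : 0 ≤ x := mul_nonneg ht hL0
  have hB0 : 0 ≤ B := (abs_nonneg _).trans (hB 0)
  have hsum := hasSum_integral_compoundPoissonLaw (lam := lam) ht hg.stronglyMeasurable hB
  have htail := (hasSum_nat_add_iff' 2).2 hsum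
  set I := ∫ y, g y ∂lam with hI
  have hIle : |t * I| ≤ x * B := by
    rw [abs_mul, abs_of_nonneg ht, hx, mul_assoc]
    refine mul_le_mul_of_nonneg_left ?_ ht
    have := norm_integral_convPow_le (lam := lam) (g := g) hB 1
    rw [convPow_one, pow_one] at this
    linarith [this, mul_comm B L, Real.norm_eq_abs (∫ y, g y ∂lam)]
  have hint : ∫ y, (g y - g 0) ∂lam = I - L * g 0 := by
    rw [integral_sub (Integrable.of_bound hg.aestronglyMeasurable B (Eventually.of_forall hB))
      (integrable_const _)]
    simp [hL, hI]
  have hexp : HasSum (fun n : ℕ => x ^ (n + 2) / (n + 2).factorial) (Real.exp x - 1 - x) := by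
    have := (hasSum_nat_add_iff' 2).2 (NormedSpace.expSeries_div_hasSum_exp x)
    rw [← Real.exp_eq_exp_ℝ] at this
    convert! this using 1
    simp [Finset.sum_range_succ]; ring
  have hR : |∫ y, g y ∂compoundPoissonLaw lam t - Real.exp (-x) * g 0 - Real.exp (-x) * (t * I)| ≤
      Real.exp (-x) * B * (Real.exp x - 1 - x) := by
    have h1 := htail.norm_le_of_bounded (hexp.mul_left (Real.exp (-x) * B)) (fun n => ?_)
    · rw [Real.norm_eq_abs] at h1
      refine le_trans (le_of_eq ?_) h1
      congr 1
      simp [Finset.sum_range_succ, poissonWeight, convPow]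
      ring
    · rw [norm_smul, Real.norm_of_nonneg (poissonWeight_nonneg ht _)]
      calc _ ≤ poissonWeight lam t (n + 2) * (B * L ^ (n + 2)) :=
            mul_le_mul_of_nonneg_left (norm_integral_convPow_le hB _) (poissonWeight_nonneg ht _)
        _ = _ := by rw [poissonWeight, ← hL, ← hx, hx, mul_pow]; ring
  have he1 : |Real.exp (-x) - 1 + x| ≤ x ^ 2 := by
    have := Real.abs_exp_sub_one_sub_id_le (x := -x) (by rwa [abs_neg, abs_of_nonneg hx0])
    simpa using this
  have he2 : |Real.exp (-x) - 1| ≤ x := by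
    have h1 := Real.add_one_le_exp (-x)
    have h2 : Real.exp (-x) ≤ 1 := Real.exp_le_one_iff.2 (by linarith)
    rw [abs_le]; constructor <;> linarith
  have he3 : Real.exp (-x) * (Real.exp x - 1 - x) ≤ x ^ 2 := by
    have h1 := Real.abs_exp_sub_one_sub_id_le (x := x) (by rwa [abs_of_nonneg hx0])
    have h2 : Real.exp (-x) ≤ 1 := Real.exp_le_one_iff.2 (by linarith)
    have h3 := Real.add_one_le_exp x
    calc _ ≤ 1 * (Real.exp x - 1 - x) := mul_le_mul_of_nonneg_right h2 (by linarith)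
      _ ≤ x ^ 2 := by rw [one_mul]; exact (le_abs_self _).trans h1
  -- Zero and one jump are split off. The tail of at least two jumps, and the two errors from
  -- replacing `e^{-x}` by `1 - x` and by `1`, are each at most `B x²`; hence the constant `3`.
  have hdecomp : ∫ y, g y ∂compoundPoissonLaw lam t - g 0 - t * ∫ y, (g y - g 0) ∂lam =
      (∫ y, g y ∂compoundPoissonLaw lam t - Real.exp (-x) * g 0 - Real.exp (-x) * (t * I)) +
      (Real.exp (-x) - 1 + x) * g 0 + (Real.exp (-x) - 1) * (t * I) := by
    rw [hint, hx]; ring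
  rw [hdecomp]
  refine (abs_add_three _ _ _).trans ?_
  have hb1 : |(Real.exp (-x) - 1 + x) * g 0| ≤ x ^ 2 * B := by
    rw [abs_mul]; exact mul_le_mul he1 (hB 0) (abs_nonneg _) (sq_nonneg _)
  have hb2 : |(Real.exp (-x) - 1) * (t * I)| ≤ x * (x * B) := by
    rw [abs_mul]; exact mul_le_mul he2 hIle (abs_nonneg _) hx0
  have hb3 : Real.exp (-x) * B * (Real.exp x - 1 - x) ≤ x ^ 2 * B := by
    calc _ = Real.exp (-x) * (Real.exp x - 1 - x) * B := by ring
      _ ≤ _ := mul_le_mul_of_nonneg_right he3 hB0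
  linarith [hR, hb1, hb2, hb3, show x * (x * B) = x ^ 2 * B by ring]

end CompoundPoisson

/-- A measure whose characteristic function is `1` at `2π / h` is carried by `ℤ_h`. -/
lemma ae_mem_lattice_of_charFun_eq_one {μ : Measure ℝ} [IsProbabilityMeasure μ] {h : ℝ}
    (hh : 0 < h) (hμ : charFun μ (2 * Real.pi / h) = 1) : ∀ᵐ x ∂μ, x ∈ lattice h := by
  have hint : Integrable (fun x : ℝ => Complex.exp ((2 * Real.pi / h : ℝ) * x * Complex.I)) μ :=
    Integrable.of_bound (Measurable.aestronglyMeasurable (by fun_prop)) 1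
      (Eventually.of_forall fun x => by
        rw [← Complex.ofReal_mul, Complex.norm_exp_ofReal_mul_I])
  have hcos : ∫ x, Real.cos (2 * Real.pi / h * x) ∂μ = 1 := by
    have h1 := integral_re hint
    rw [← charFun_apply_real, hμ] at h1
    simp only [RCLike.re_to_complex, Complex.one_re] at h1
    rw [← h1]
    congr with x
    rw [← Complex.ofReal_mul, Complex.exp_ofReal_mul_I_re]
  have hci : Integrable (fun x => Real.cos (2 * Real.pi / h * x)) μ :=
    Integrable.of_bound (Measurable.aestronglyMeasurable (by fun_prop)) 1
      (Eventually.of_forall fun x => Real.abs_cos_le_one _)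
  -- A nonnegative function with zero integral vanishes a.e., so the cosine equals `1` a.e., which
  -- happens only on `ℤ_h`.
  have hzero : ∫ x, (1 - Real.cos (2 * Real.pi / h * x)) ∂μ = 0 := by
    rw [integral_sub (integrable_const _) hci, hcos]; simp
  have hnn : (0 : ℝ → ℝ) ≤ fun x => 1 - Real.cos (2 * Real.pi / h * x) := fun x => by
    simpa using Real.cos_le_one _
  rw [integral_eq_zero_iff_of_nonneg hnn ((integrable_const _).sub hci)] at hzero
  filter_upwards [hzero] with x hx
  have hx' : Real.cos (2 * Real.pi / h * x) = 1 := by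
    simp only [Pi.zero_apply] at hx; linarith
  obtain ⟨k, hk⟩ := (Real.cos_eq_one_iff _).1 hx'
  refine ⟨k, ?_⟩
  have := Real.pi_pos
  field_simp at hk
  simpa [mul_comm] using hk

/-! ### Exit from `[0, N)` for integer random walks with i.i.d. steps. -/

section RandomWalk

/-- The walk started at `n` with steps `x`. -/
def walk (n : ℤ) (x : ℕ → ℤ) (j : ℕ) : ℤ := n + ∑ l ∈ Finset.range j, x l

/-- The sequences that stay in `[0, N)` up to the index `i`. -/
def aliveSet (N i : ℕ) : Set (ℕ → ℤ) := {s | ∀ j ≤ i, 0 ≤ s j ∧ s j < N}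

/-- The sequences that leave `[0, N)` upwards, at the index `i` at the latest. -/
def upSet (N i : ℕ) : Set (ℕ → ℤ) :=
  {s | ∃ j ≤ i, (N : ℤ) ≤ s j ∧ ∀ l < j, 0 ≤ s l ∧ s l < N}

lemma measurable_walk (n : ℤ) : Measurable (walk n) := by
  unfold walk
  refine measurable_pi_lambda _ fun j => ?_
  fun_prop

lemma walk_succ (n : ℤ) (x : ℕ → ℤ) (j : ℕ) : walk n x (j + 1) = walk n x j + x j := by
  simp [walk, Finset.sum_range_succ, add_assoc]

lemma measurableSet_coord_mem (N j : ℕ) :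
    MeasurableSet {s : ℕ → ℤ | 0 ≤ s j ∧ s j < N} := by
  change MeasurableSet ((fun s : ℕ → ℤ => s j) ⁻¹' Set.Ico (0 : ℤ) N)
  exact measurable_pi_apply j measurableSet_Ico

lemma measurableSet_aliveSet (N i : ℕ) : MeasurableSet (aliveSet N i) := by
  have : aliveSet N i = ⋂ j, ⋂ (_ : j ≤ i), {s : ℕ → ℤ | 0 ≤ s j ∧ s j < N} := by
    ext s; simp [aliveSet]
  rw [this]
  exact .iInter fun j => .iInter fun _ => measurableSet_coord_mem N j

lemma measurableSet_upSet (N i : ℕ) : MeasurableSet (upSet N i) := by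
  have : upSet N i = ⋃ j, ⋃ (_ : j ≤ i), ({s : ℕ → ℤ | (N : ℤ) ≤ s j} ∩
      ⋂ l, ⋂ (_ : l < j), {s : ℕ → ℤ | 0 ≤ s l ∧ s l < N}) := by
    ext s; simp [upSet, and_left_comm]
  rw [this]
  refine .iUnion fun j => .iUnion fun _ => .inter ?_
    (.iInter fun l => .iInter fun _ => measurableSet_coord_mem N l)
  exact measurable_pi_apply j measurableSet_Ici

lemma mem_aliveSet_succ {N i : ℕ} {s : ℕ → ℤ} :
    s ∈ aliveSet N (i + 1) ↔ s ∈ aliveSet N i ∧ 0 ≤ s (i + 1) ∧ s (i + 1) < N := by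
  simp only [aliveSet, Set.mem_ofPred_eq]
  constructor
  · intro h
    exact ⟨fun j hj => h j (by omega), h _ le_rfl⟩
  · rintro ⟨h1, h2⟩ j hj
    rcases Nat.lt_or_ge i j with h | h
    · obtain rfl : j = i + 1 := by omega
      exact h2
    · exact h1 j h

lemma mem_upSet_succ {N i : ℕ} {s : ℕ → ℤ} :
    s ∈ upSet N (i + 1) ↔ s ∈ upSet N i ∨ (s ∈ aliveSet N i ∧ (N : ℤ) ≤ s (i + 1)) := by
  simp only [upSet, aliveSet, Set.mem_ofPred_eq]
  constructor
  · rintro ⟨j, hj, h1, h2⟩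
    rcases Nat.lt_or_ge i j with h | h
    · obtain rfl : j = i + 1 := by omega
      exact Or.inr ⟨fun l hl => h2 l (by omega), h1⟩
    · exact Or.inl ⟨j, h, h1, h2⟩
  · rintro (⟨j, hj, h⟩ | ⟨h1, h2⟩)
    · exact ⟨j, by omega, h⟩
    · exact ⟨i + 1, le_rfl, h2, fun l hl => h1 l (by omega)⟩

lemma notMem_upSet_of_mem_aliveSet {N i : ℕ} {s : ℕ → ℤ} (h : s ∈ aliveSet N i) :
    s ∉ upSet N i := by
  rintro ⟨j, hj, h1, -⟩
  have := (h j hj).2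
  omega

/-- The value of `f` at the walk stopped on leaving `[0, N)`, if `f` vanishes on the negative
integers. -/
noncomputable def stoppedValueAt (f : ℤ → ℝ) (N i : ℕ) (s : ℕ → ℤ) : ℝ :=
  (aliveSet N i).indicator (fun s => f (s i)) s + (upSet N i).indicator (fun _ => f N) s

/-- The conditions on `f` outside `[0, N)` make the stopped value insensitive to the overshoot: a
downward exit contributes `0`, an upward one always `f N`. Several grid-step jumps may overshoot
`N`, even for a skip-free chain. -/
lemma stoppedValueAt_succ {f : ℤ → ℝ} {N : ℕ} (hneg : ∀ k < 0, f k = 0)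
    (htop : ∀ k : ℤ, N ≤ k → f k = f N) (i : ℕ) (s : ℕ → ℤ) :
    stoppedValueAt f N (i + 1) s = stoppedValueAt f N i s +
      (aliveSet N i).indicator (fun s => f (s (i + 1)) - f (s i)) s := by
  unfold stoppedValueAt
  classical
  simp only [Set.indicator_apply, mem_aliveSet_succ, mem_upSet_succ]
  by_cases ha : s ∈ aliveSet N i
  · have hu := notMem_upSet_of_mem_aliveSet ha
    simp only [ha, hu, true_and, if_true, if_false, false_or]
    by_cases h1 : (N : ℤ) ≤ s (i + 1)
    · rw [if_pos h1, if_neg (by omega), htop _ h1]; ring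
    · by_cases h2 : 0 ≤ s (i + 1)
      · rw [if_neg h1, if_pos ⟨h2, by omega⟩]; ring
      · have h3 := hneg _ (not_le.1 h2)
        simp [h1, h2, h3]
  · simp [ha]

variable {Ω : Type*} [MeasurableSpace Ω] {P : Measure Ω} {ξ : ℕ → Ω → ℤ}

lemma indepFun_truncate (hind : iIndepFun ξ P) (hm : ∀ i, Measurable (ξ i)) (i : ℕ) :
    IndepFun (fun ω (l : ℕ) => if l < i then ξ l ω else 0) (ξ i) P := by
  have h := hind.indepFun_finset (Finset.range i) {i} (by simp) hm
  let φ : (Finset.range i → ℤ) → ℕ → ℤ := fun v l =>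
    if hl : l ∈ Finset.range i then v ⟨l, hl⟩ else 0
  have hφ : Measurable φ := by
    refine measurable_pi_lambda _ fun l => ?_
    by_cases hl : l ∈ Finset.range i
    · simp only [φ, hl, dite_true]; exact measurable_pi_apply _
    · simp only [φ, hl, dite_false]; exact measurable_const
  have hψ : Measurable fun v : ({i} : Finset ℕ) → ℤ => v ⟨i, by simp⟩ := measurable_pi_apply _
  have := h.comp hφ hψ
  convert! this using 1
  ext ω l
  simp [φ]

variable [IsProbabilityMeasure P] {μ : Measure ℤ}

/-- The Markov property at index `i`: survival up to `i` and the position at `i` depend only on the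
steps before `i`, so Fubini integrates out the independent step `ξ i`. -/
lemma integral_indicator_aliveSet_step (hind : iIndepFun ξ P) (hm : ∀ i, Measurable (ξ i))
    (hμ : ∀ i, P.map (ξ i) = μ) {f : ℤ → ℝ} {B : ℝ} (hB : ∀ k, |f k| ≤ B) (n : ℤ) (N i : ℕ) :
    ∫ ω, (aliveSet N i).indicator (fun s => f (s (i + 1)) - f (s i)) (walk n (ξ · ω)) ∂P =
      ∫ ω, (aliveSet N i).indicator (fun s => ∫ x, (f (s i + x) - f (s i)) ∂μ)
        (walk n (ξ · ω)) ∂P := by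
  -- The past, padded with zeros: it is independent of `ξ i` and yields the same walk up to index
  -- `i`.
  set U : Ω → ℕ → ℤ := fun ω l => if l < i then ξ l ω else 0 with hU
  have hUm : Measurable U := by
    refine measurable_pi_lambda _ fun l => ?_
    by_cases hl : l < i
    · simp only [hU, hl, if_true]; exact hm l
    · simp only [hU, hl, if_false]; exact measurable_const
  have hwalk : ∀ ω, ∀ j ≤ i, walk n (ξ · ω) j = walk n (U ω) j := by
    intro ω j hj
    simp only [walk, hU]
    congr 1
    refine Finset.sum_congr rfl fun l hl => ?_
    rw [if_pos (by simp at hl; omega)]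
  have halive : ∀ ω, walk n (ξ · ω) ∈ aliveSet N i ↔ walk n (U ω) ∈ aliveSet N i := by
    intro ω
    simp only [aliveSet, Set.mem_ofPred_eq]
    exact forall₂_congr fun j hj => by rw [hwalk ω j hj]
  have hfm : Measurable f := measurable_from_top
  let F : (ℕ → ℤ) × ℤ → ℝ := fun z =>
    (aliveSet N i).indicator (fun s => f (s i + z.2) - f (s i)) (walk n z.1)
  have hFm : Measurable F := by
    have : F = ((fun z : (ℕ → ℤ) × ℤ => walk n z.1) ⁻¹' aliveSet N i).indicator
        fun z => f (walk n z.1 i + z.2) - f (walk n z.1 i) := by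
      ext z; rfl
    have hw : Measurable fun z : (ℕ → ℤ) × ℤ => walk n z.1 :=
      (measurable_walk n).comp measurable_fst
    rw [this]
    refine Measurable.indicator ?_ (hw (measurableSet_aliveSet N i))
    have hwi : Measurable fun z : (ℕ → ℤ) × ℤ => walk n z.1 i := (measurable_pi_apply i).comp hw
    exact (hfm.comp (hwi.add measurable_snd)).sub (hfm.comp hwi)
  have hmap : P.map (fun ω => (U ω, ξ i ω)) = (P.map U).prod μ := by
    rw [← hμ i]
    exact (indepFun_iff_map_prod_eq_prod_map_map hUm.aemeasurable (hm i).aemeasurable).1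
      (indepFun_truncate hind hm i)
  have : IsProbabilityMeasure μ := by
    rw [← hμ i]; exact Measure.isProbabilityMeasure_map (hm i).aemeasurable
  have : IsProbabilityMeasure (P.map U) := Measure.isProbabilityMeasure_map hUm.aemeasurable
  have hFi : Integrable F ((P.map U).prod μ) := by
    refine Integrable.of_bound hFm.aestronglyMeasurable (B + B) (Eventually.of_forall fun z => ?_)
    refine (norm_indicator_le_norm_self _ _).trans ?_
    exact (norm_sub_le _ _).trans (add_le_add (hB _) (hB _))
  calc _ = ∫ ω, F (U ω, ξ i ω) ∂P := by
        congr with ω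
        classical
        simp only [F, Set.indicator_apply, halive, walk_succ, hwalk ω i le_rfl]
    _ = ∫ z, F z ∂((P.map U).prod μ) := by
        rw [← hmap, integral_map (hUm.prodMk (hm i)).aemeasurable hFm.aestronglyMeasurable]
    _ = ∫ u, ∫ x, F (u, x) ∂μ ∂(P.map U) := integral_prod _ hFi
    _ = ∫ ω, ∫ x, F (U ω, x) ∂μ ∂P :=
        integral_map hUm.aemeasurable hFi.aestronglyMeasurable.integral_prod_right'
    _ = _ := by
        congr with ω
        classical
        simp only [F, Set.indicator_apply, halive, hwalk ω i le_rfl]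
        split_ifs <;> simp

variable (hind : iIndepFun ξ P) (hm : ∀ i, Measurable (ξ i)) (hμ : ∀ i, P.map (ξ i) = μ)
include hm

lemma measurable_walk_comp (n : ℤ) : Measurable fun ω => walk n (ξ · ω) :=
  (measurable_walk n).comp (measurable_pi_lambda _ hm)

lemma integrable_indicator_walk {A : Set (ℕ → ℤ)} (hA : MeasurableSet A) {g : (ℕ → ℤ) → ℝ}
    (hg : Measurable g) {B : ℝ} (hB : ∀ s, |g s| ≤ B) (n : ℤ) :
    Integrable (fun ω => A.indicator g (walk n (ξ · ω))) P := by
  refine Integrable.of_bound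
    ((hg.indicator hA).comp (measurable_walk_comp hm n)).aestronglyMeasurable B
    (Eventually.of_forall fun ω => ?_)
  exact (norm_indicator_le_norm_self _ _).trans (hB _)

include hind hμ

/-- Optional stopping for an approximate martingale: each step made inside `[0, N)` changes the mean
by at most `ε`. -/
lemma abs_integral_stoppedValueAt_sub_le {f : ℤ → ℝ} {N n : ℕ} (hn : n < N)
    (hneg : ∀ k < 0, f k = 0) (htop : ∀ k : ℤ, N ≤ k → f k = f N) {B : ℝ}
    (hB : ∀ k, |f k| ≤ B) {ε : ℝ} (hε : 0 ≤ ε)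
    (hd : ∀ k : ℤ, 0 ≤ k → k < N → |∫ x, (f (k + x) - f k) ∂μ| ≤ ε) (i : ℕ) :
    |∫ ω, stoppedValueAt f N i (walk n (ξ · ω)) ∂P - f n| ≤ i * ε := by
  have hfm : Measurable f := measurable_from_top
  have hcoord : ∀ j, Measurable fun s : ℕ → ℤ => f (s j) := fun j =>
    hfm.comp (measurable_pi_apply j)
  have hint : ∀ i, Integrable (fun ω => stoppedValueAt f N i (walk n (ξ · ω))) P := fun i =>
    (integrable_indicator_walk hm (measurableSet_aliveSet N i) (hcoord i) (fun s => hB _) n).add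
      (integrable_indicator_walk hm (measurableSet_upSet N i) measurable_const (fun s => hB _) n)
  induction i with
  | zero =>
    have : ∀ x, stoppedValueAt f N 0 (walk n x) = f n := by
      intro x
      have h1 : walk n x ∈ aliveSet N 0 := by
        intro j hj
        obtain rfl : j = 0 := by omega
        simp [walk, hn]
      rw [stoppedValueAt, Set.indicator_of_mem h1,
        Set.indicator_of_notMem (notMem_upSet_of_mem_aliveSet h1)]
      simp [walk]
    simp [this]
  | succ i ih =>
    have hstep : |∫ ω, (aliveSet N i).indicator (fun s => f (s (i + 1)) - f (s i))
        (walk n (ξ · ω)) ∂P| ≤ ε := by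
      rw [integral_indicator_aliveSet_step hind hm hμ hB]
      have := norm_integral_le_of_norm_le_const (μ := P) (C := ε)
        (f := fun ω => (aliveSet N i).indicator (fun s => ∫ x, (f (s i + x) - f (s i)) ∂μ)
          (walk n (ξ · ω))) (Eventually.of_forall fun ω => ?_)
      · simpa using this
      · by_cases ha : walk n (ξ · ω) ∈ aliveSet N i
        · rw [Set.indicator_of_mem ha]
          exact hd _ (ha i le_rfl).1 (ha i le_rfl).2
        · rw [Set.indicator_of_notMem ha]; simpa using hε
    simp_rw [stoppedValueAt_succ hneg htop]
    rw [integral_add (hint i)]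
    · push_cast
      have := abs_add_le (∫ ω, stoppedValueAt f N i (walk n (ξ · ω)) ∂P - f n)
        (∫ ω, (aliveSet N i).indicator (fun s => f (s (i + 1)) - f (s i)) (walk n (ξ · ω)) ∂P)
      rw [add_sub_right_comm]
      linarith
    · exact integrable_indicator_walk hm (measurableSet_aliveSet N i)
        ((hcoord (i + 1)).sub (hcoord i))
        (fun s => (abs_sub _ _).trans (add_le_add (hB _) (hB _))) n

lemma abs_up_probability_sub_le {f : ℤ → ℝ} {N n : ℕ} (hn : n < N)
    (hneg : ∀ k < 0, f k = 0) (htop : ∀ k : ℤ, N ≤ k → f k = f N) {B : ℝ}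
    (hB : ∀ k, |f k| ≤ B) {ε : ℝ} (hε : 0 ≤ ε)
    (hd : ∀ k : ℤ, 0 ≤ k → k < N → |∫ x, (f (k + x) - f k) ∂μ| ≤ ε) (i : ℕ) :
    |P.real {ω | walk n (ξ · ω) ∈ upSet N i} * f N - f n| ≤
      i * ε + B * P.real {ω | walk n (ξ · ω) ∈ aliveSet N i} := by
  have h1 := abs_integral_stoppedValueAt_sub_le hind hm hμ hn hneg htop hB hε hd i
  have hfm : Measurable fun s : ℕ → ℤ => f (s i) :=
    (measurable_from_top (f := f)).comp (measurable_pi_apply i)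
  have hwm := measurable_walk_comp hm n
  unfold stoppedValueAt at h1
  rw [integral_add
    (integrable_indicator_walk hm (measurableSet_aliveSet N i) hfm (fun s => hB _) n)
    (integrable_indicator_walk hm (measurableSet_upSet N i) measurable_const (fun s => hB _) n)]
    at h1
  have h2 : ∫ ω, (upSet N i).indicator (fun _ => f N) (walk n (ξ · ω)) ∂P =
      P.real {ω | walk n (ξ · ω) ∈ upSet N i} * f N := by
    have := integral_indicator_const (μ := P) (f N) (hwm (measurableSet_upSet N i))
    rw [smul_eq_mul] at this
    exact this
  have h3 : |∫ ω, (aliveSet N i).indicator (fun s => f (s i)) (walk n (ξ · ω)) ∂P| ≤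
      B * P.real {ω | walk n (ξ · ω) ∈ aliveSet N i} := by
    have h4 := integral_indicator (μ := P) (f := fun ω => f (walk n (ξ · ω) i))
      (hwm (measurableSet_aliveSet N i))
    have h5 : ∫ ω, (aliveSet N i).indicator (fun s => f (s i)) (walk n (ξ · ω)) ∂P =
      ∫ ω in (fun ω => walk n (ξ · ω)) ⁻¹' aliveSet N i, f (walk n (ξ · ω) i) ∂P := h4
    rw [h5]
    exact norm_setIntegral_le_of_norm_le_const
      (f := fun ω => f (walk n (ξ · ω) i)) (measure_lt_top _ _) (fun ω _ => hB _)
  rw [h2] at h1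
  rw [abs_le] at *
  constructor <;> linarith [h1.1, h1.2, h3.1, h3.2]

/-- A drift bound on the survival time. While alive, the mean of `g` gains at least `η` per step,
and replacing `g` by `0` at the exit only helps since `g ≤ 0`. The mean starts at or above `-B` and
never exceeds `0`, so the total gain is at most `B`; survival probabilities decrease, so the last
one bounds every summand below. -/
lemma mul_alive_probability_le {g : ℤ → ℝ} {N n : ℕ} (hg : ∀ k, g k ≤ 0) {B : ℝ}
    (hB : ∀ k, |g k| ≤ B) {η : ℝ} (hη : 0 ≤ η)
    (hd : ∀ k : ℤ, 0 ≤ k → k < N → η ≤ ∫ x, (g (k + x) - g k) ∂μ) (i : ℕ) :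
    i * (η * P.real {ω | walk n (ξ · ω) ∈ aliveSet N i}) ≤ B := by
  have hgm : ∀ j, Measurable fun s : ℕ → ℤ => g (s j) := fun j =>
    (measurable_from_top (f := g)).comp (measurable_pi_apply j)
  have hwm := measurable_walk_comp hm n
  have hmono : ∀ i, P.real {ω | walk n (ξ · ω) ∈ aliveSet N (i + 1)} ≤
      P.real {ω | walk n (ξ · ω) ∈ aliveSet N i} := fun i =>
    measureReal_mono fun ω hω => (mem_aliveSet_succ.1 hω).1
  have hint : ∀ i j, Integrable (fun ω => (aliveSet N i).indicator (fun s => g (s j))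
      (walk n (ξ · ω))) P := fun i j =>
    integrable_indicator_walk hm (measurableSet_aliveSet N i) (hgm j) (fun s => hB _) n
  have hstep : ∀ i, ∫ ω, (aliveSet N i).indicator (fun s => g (s i)) (walk n (ξ · ω)) ∂P +
      η * P.real {ω | walk n (ξ · ω) ∈ aliveSet N i} ≤
      ∫ ω, (aliveSet N (i + 1)).indicator (fun s => g (s (i + 1))) (walk n (ξ · ω)) ∂P := by
    intro i
    have h1 : η * P.real {ω | walk n (ξ · ω) ∈ aliveSet N i} ≤
        ∫ ω, (aliveSet N i).indicator (fun s => g (s (i + 1)) - g (s i)) (walk n (ξ · ω)) ∂P := by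
      have h2 := integral_indicator_const (μ := P) η (hwm (measurableSet_aliveSet N i))
      rw [smul_eq_mul, mul_comm] at h2
      rw [integral_indicator_aliveSet_step hind hm hμ hB]
      refine h2.symm.le.trans (integral_mono_of_nonneg (Eventually.of_forall fun ω =>
        Set.indicator_nonneg (fun _ _ => hη) _) ?_ (Eventually.of_forall fun ω => ?_))
      · refine integrable_indicator_walk hm (measurableSet_aliveSet N i) ?_
          (B := (B + B) * μ.real Set.univ) (fun s => ?_) n
        · exact (measurable_from_top (f := fun k : ℤ => ∫ x, (g (k + x) - g k) ∂μ)).comp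
            (measurable_pi_apply i)
        · have : IsProbabilityMeasure μ := by
            rw [← hμ i]; exact Measure.isProbabilityMeasure_map (hm i).aemeasurable
          exact norm_integral_le_of_norm_le_const (f := fun x => g (s i + x) - g (s i))
            (Eventually.of_forall fun x => (abs_sub _ _).trans (add_le_add (hB _) (hB _)))
      · by_cases ha : walk n (ξ · ω) ∈ aliveSet N i
        · classical
          simp only [Set.indicator_apply, Set.mem_preimage, ha, if_true]
          exact hd _ (ha i le_rfl).1 (ha i le_rfl).2
        · classical
          simp only [Set.indicator_apply, Set.mem_preimage, ha, if_false, le_refl]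
    have h3 : ∫ ω, (aliveSet N i).indicator (fun s => g (s (i + 1)) - g (s i))
        (walk n (ξ · ω)) ∂P =
        ∫ ω, (aliveSet N i).indicator (fun s => g (s (i + 1))) (walk n (ξ · ω)) ∂P -
        ∫ ω, (aliveSet N i).indicator (fun s => g (s i)) (walk n (ξ · ω)) ∂P := by
      rw [← integral_sub (hint i (i + 1)) (hint i i)]
      congr with ω
      classical
      simp only [Set.indicator_apply]
      split_ifs <;> simp
    have h4 : ∫ ω, (aliveSet N i).indicator (fun s => g (s (i + 1))) (walk n (ξ · ω)) ∂P ≤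
        ∫ ω, (aliveSet N (i + 1)).indicator (fun s => g (s (i + 1))) (walk n (ξ · ω)) ∂P := by
      refine integral_mono (hint _ _) (hint _ _) fun ω => ?_
      classical
      simp only [Set.indicator_apply, mem_aliveSet_succ]
      split_ifs with h5 h6 h6
      · exact le_rfl
      · exact hg _
      · exact absurd h6.1 h5
      · exact le_rfl
    linarith
  have hB0 : 0 ≤ B := (abs_nonneg _).trans (hB 0)
  have hind2 : ∀ i : ℕ, -B + i * (η * P.real {ω | walk n (ξ · ω) ∈ aliveSet N i}) ≤
      ∫ ω, (aliveSet N i).indicator (fun s => g (s i)) (walk n (ξ · ω)) ∂P := by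
    intro i
    induction i with
    | zero =>
      have := norm_integral_le_of_norm_le_const (μ := P) (C := B)
        (f := fun ω => (aliveSet N 0).indicator (fun s => g (s 0)) (walk n (ξ · ω)))
        (Eventually.of_forall fun ω => (norm_indicator_le_norm_self _ _).trans (hB _))
      simp only [probReal_univ, mul_one, Real.norm_eq_abs] at this
      simpa using (abs_le.1 this).1
    | succ i ih =>
      have h1 := hstep i
      have h2 : ((i + 1 : ℕ) : ℝ) * (η * P.real {ω | walk n (ξ · ω) ∈ aliveSet N (i + 1)}) ≤
          ((i + 1 : ℕ) : ℝ) * (η * P.real {ω | walk n (ξ · ω) ∈ aliveSet N i}) :=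
        mul_le_mul_of_nonneg_left (mul_le_mul_of_nonneg_left (hmono i) hη) (Nat.cast_nonneg _)
      push_cast at h2 ⊢
      linarith
  have h0 : ∫ ω, (aliveSet N i).indicator (fun s => g (s i)) (walk n (ξ · ω)) ∂P ≤ 0 :=
    integral_nonpos fun ω => Set.indicator_nonpos (fun _ _ => hg _) _
  linarith [hind2 i]

end RandomWalk

/-! ### The lattice, the jump measure and the generator on `ℤ`. -/

section Lattice

variable {h : ℝ}

lemma isClosed_lattice (hh : h ≠ 0) : IsClosed (lattice h) := by
  have : lattice h = (Homeomorph.mulLeft₀ h hh) '' Set.range ((↑) : ℤ → ℝ) := by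
    ext x; simp [lattice]
  rw [this, Homeomorph.isClosed_image]
  exact Int.isClosedEmbedding_coe_real.isClosed_range

lemma floor_mul_div (hh : 0 < h) (k : ℤ) : ⌊h * (k : ℝ) / h⌋ = k := by
  rw [mul_div_cancel_left₀ _ hh.ne', Int.floor_intCast]

end Lattice

section JumpMeasure

/-- The Lévy measures of upwards skip-free Lévy chains. -/
structure IsSkipFreeMeasure (lam : Measure ℝ) (h : ℝ) : Prop where
  finite : IsFiniteMeasure lam
  no_atom_zero : lam {0} = 0
  h_pos : 0 < h
  support_subset : lam.support ⊆ lattice h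
  support_pos : (lam.restrict (Set.Ioi 0)).support = {h}

variable {lam : Measure ℝ} {h : ℝ}

lemma IsSkipFreeMeasure.ae_mem_lattice (H : IsSkipFreeMeasure lam h) :
    ∀ᵐ x ∂lam, x ∈ lattice h := by
  have := H.finite
  have h1 : lam lam.supportᶜ = 0 := Measure.measure_compl_support_of_regular
  exact measure_mono_null (Set.compl_subset_compl.2 H.support_subset) h1

lemma IsSkipFreeMeasure.ae_eq_of_pos (H : IsSkipFreeMeasure lam h) :
    ∀ᵐ x ∂lam, 0 < x → x = h := by
  have := H.finite
  have h1 : (lam.restrict (Set.Ioi 0)) (lam.restrict (Set.Ioi 0)).supportᶜ = 0 :=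
    Measure.measure_compl_support_of_regular
  rw [H.support_pos] at h1
  have h2 : ∀ᵐ x ∂lam.restrict (Set.Ioi 0), x = h := h1
  exact (ae_restrict_iff' measurableSet_Ioi).1 h2

lemma IsSkipFreeMeasure.Ioi_ae_eq (H : IsSkipFreeMeasure lam h) :
    (Set.Ioi 0 : Set ℝ) =ᵐ[lam] ({h} : Set ℝ) := by
  filter_upwards [H.ae_eq_of_pos] with x hx
  refine propext ⟨fun hp => hx hp, fun he => ?_⟩
  obtain rfl : x = h := he
  exact H.h_pos

lemma IsSkipFreeMeasure.up_pos (H : IsSkipFreeMeasure lam h) : 0 < lam.real {h} := by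
  have := H.finite
  rw [measureReal_def, ENNReal.toReal_pos_iff]
  refine ⟨?_, measure_lt_top _ _⟩
  rw [← measure_congr H.Ioi_ae_eq, pos_iff_ne_zero]
  intro h0
  have h1 := H.support_pos
  rw [Measure.restrict_eq_zero.2 h0] at h1
  simp at h1

/-- The mass of the jump of size `-h i`. -/
noncomputable def downMass (lam : Measure ℝ) (h : ℝ) (i : ℕ) : ℝ := lam.real {-(h * i)}

/-- The two support conditions concentrate `lam` on `h` and the points `-(h * i)`. The index `i = 0`
is harmless: its mass is `lam {0} = 0`. -/
lemma IsSkipFreeMeasure.hasSum_integral (H : IsSkipFreeMeasure lam h) {G : ℝ → ℝ}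
    (hG : Integrable G lam) :
    HasSum (fun i : ℕ => downMass lam h i * G (-(h * i)))
      (∫ x, G x ∂lam - lam.real {h} * G h) := by
  have := H.finite
  have hae : (Set.Iic 0 : Set ℝ) =ᵐ[lam] (⋃ i : ℕ, ({-(h * (i : ℝ))} : Set ℝ)) := by
    filter_upwards [H.ae_mem_lattice] with x hx
    obtain ⟨k, rfl⟩ := hx
    refine propext ⟨fun hp => ?_, fun he => ?_⟩
    · have hk : k ≤ 0 := by
        have h1 : h * (k : ℝ) ≤ 0 := hp
        have h2 : (k : ℝ) ≤ 0 := by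
          by_contra hcon
          exact absurd h1 (not_le.2 (mul_pos H.h_pos (not_le.1 hcon)))
        exact_mod_cast h2
      obtain ⟨m, hm⟩ := Int.eq_ofNat_of_zero_le (neg_nonneg.2 hk)
      obtain rfl : k = -(m : ℤ) := by omega
      exact Set.mem_iUnion.2 ⟨m, by simp⟩
    · obtain ⟨i, hi⟩ := Set.mem_iUnion.1 he
      have hi' : h * (k : ℝ) = -(h * i) := hi
      change h * (k : ℝ) ≤ 0
      rw [hi']
      have := mul_nonneg H.h_pos.le (Nat.cast_nonneg (α := ℝ) i)
      linarith
  have hsplit : ∫ x, G x ∂lam - lam.real {h} * G h =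
      ∫ x in ⋃ i : ℕ, ({-(h * (i : ℝ))} : Set ℝ), G x ∂lam := by
    rw [← setIntegral_congr_set hae]
    have h1 := integral_add_compl (measurableSet_Iic (a := (0 : ℝ))) hG
    rw [Set.compl_Iic, setIntegral_congr_set H.Ioi_ae_eq, integral_singleton, smul_eq_mul] at h1
    linarith
  rw [hsplit]
  have h2 := hasSum_integral_iUnion (μ := lam) (f := G)
    (s := fun i : ℕ => ({-(h * (i : ℝ))} : Set ℝ)) (fun i => measurableSet_singleton _) ?_
    hG.integrableOn
  · refine h2.congr_fun fun i => ?_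
    rw [integral_singleton, smul_eq_mul, downMass]
  · intro i j hij
    simp only [Function.onFun, Set.disjoint_singleton]
    intro he
    have h3 := mul_left_cancel₀ H.h_pos.ne' (neg_inj.1 he)
    exact hij (by exact_mod_cast h3)

lemma IsSkipFreeMeasure.isJumpData (H : IsSkipFreeMeasure lam h) :
    IsJumpData (downMass lam h) (lam.real {h}) (lam.real Set.univ) where
  nonneg i := measureReal_nonneg
  zero := by simp [downMass, measureReal_def, H.no_atom_zero]
  pos := H.up_pos
  hasSum := by
    have := H.finite
    simpa using H.hasSum_integral (integrable_const (1 : ℝ))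

/-- The generator of the chain read on `ℤ`. -/
noncomputable def latticeGenerator (lam : Measure ℝ) (h : ℝ) (f : ℤ → ℝ) (k : ℤ) : ℝ :=
  ∫ x, (f (k + ⌊x / h⌋) - f k) ∂lam

lemma measurable_floor_div (h : ℝ) : Measurable fun x : ℝ => ⌊x / h⌋ :=
  Int.measurable_floor.comp (measurable_id.div_const h)

lemma IsSkipFreeMeasure.hasSum_latticeGenerator (H : IsSkipFreeMeasure lam h) {f : ℤ → ℝ} {B : ℝ}
    (hB : ∀ k, |f k| ≤ B) (k : ℤ) :
    HasSum (fun i : ℕ => downMass lam h i * (f (k - i) - f k))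
      (latticeGenerator lam h f k - lam.real {h} * (f (k + 1) - f k)) := by
  have := H.finite
  have hfm : Measurable f := measurable_from_top
  have h1 := H.hasSum_integral (G := fun x => f (k + ⌊x / h⌋) - f k) (Integrable.of_bound
    (((hfm.comp ((measurable_floor_div h).const_add k)).sub_const _).aestronglyMeasurable) (B + B)
    (Eventually.of_forall fun x => (abs_sub _ _).trans (add_le_add (hB _) (hB _))))
  have e1 : ⌊h / h⌋ = 1 := by rw [div_self H.h_pos.ne']; simp
  have e2 : ∀ i : ℕ, ⌊-(h * (i : ℝ)) / h⌋ = -(i : ℤ) := fun i => by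
    have := floor_mul_div H.h_pos (-(i : ℤ))
    rw [← this]; push_cast; congr 2; ring
  simp only [e1, e2, ← sub_eq_add_neg] at h1
  exact h1

/-- The function on `ℤ` which vanishes on negative integers, equals `u` on `[0, N]` and is
constant afterwards. -/
def truncSeq (u : ℕ → ℝ) (N : ℕ) (k : ℤ) : ℝ := if k < 0 then 0 else u (min k.toNat N)

lemma truncSeq_of_neg (u : ℕ → ℝ) (N : ℕ) {k : ℤ} (hk : k < 0) : truncSeq u N k = 0 := if_pos hk

lemma truncSeq_of_le (u : ℕ → ℝ) (N : ℕ) {k : ℤ} (hk : (N : ℤ) ≤ k) :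
    truncSeq u N k = truncSeq u N N := by
  unfold truncSeq
  rw [if_neg (by omega), if_neg (by omega)]
  congr 1; omega

lemma truncSeq_natCast (u : ℕ → ℝ) {N n : ℕ} (hn : n ≤ N) : truncSeq u N n = u n := by
  unfold truncSeq
  rw [if_neg (by omega)]
  congr 1; omega

lemma truncSeq_nonneg {u : ℕ → ℝ} (hu : ∀ n, 0 ≤ u n) (N : ℕ) (k : ℤ) : 0 ≤ truncSeq u N k := by
  unfold truncSeq; split_ifs
  · exact le_rfl
  · exact hu _

lemma truncSeq_le {u : ℕ → ℝ} (hu : ∀ n, 0 ≤ u n) (hmono : Monotone u) (N : ℕ) (k : ℤ) :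
    truncSeq u N k ≤ u N := by
  unfold truncSeq; split_ifs
  · exact hu _
  · exact hmono (min_le_right _ _)

lemma abs_truncSeq_le {u : ℕ → ℝ} (hu : ∀ n, 0 ≤ u n) (hmono : Monotone u) (N : ℕ) (k : ℤ) :
    |truncSeq u N k| ≤ u N := by
  rw [abs_of_nonneg (truncSeq_nonneg hu N k)]; exact truncSeq_le hu hmono N k

/-- The scale sequence of the chain. -/
noncomputable def latticeScale (lam : Measure ℝ) (h : ℝ) : ℕ → ℝ :=
  scaleSeq (downMass lam h) (lam.real {h}) (lam.real Set.univ)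

/-- This is the defining recursion. For `k < N` an upward jump reaches at most `N`, so the
truncation is not seen; jumps below zero contribute `0`, which makes the sum finite. -/
lemma IsSkipFreeMeasure.latticeGenerator_scale (H : IsSkipFreeMeasure lam h) (N : ℕ) {k : ℤ}
    (hk0 : 0 ≤ k) (hkN : k < N) :
    latticeGenerator lam h (truncSeq (latticeScale lam h) N) k = 0 := by
  have J := H.isJumpData
  have hw : latticeScale lam h =
    scaleSeq (downMass lam h) (lam.real {h}) (lam.real Set.univ) := rfl
  set w := latticeScale lam h
  set c := lam.real Set.univ
  set p := lam.real {h}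
  obtain ⟨m, rfl⟩ := Int.eq_ofNat_of_zero_le hk0
  have hmN : m + 1 ≤ N := by omega
  have h1 := H.hasSum_latticeGenerator (f := truncSeq w N)
    (abs_truncSeq_le (fun n => (J.scaleSeq_pos n).le) J.scaleSeq_mono N) m
  have e0 : truncSeq w N (m : ℤ) = w m := truncSeq_natCast w (by omega)
  have e1 : truncSeq w N ((m : ℤ) + 1) = w (m + 1) := by
    have := truncSeq_natCast w hmN
    push_cast at this; exact this
  rw [e0, e1] at h1
  have h2 : HasSum (fun i : ℕ => downMass lam h i * truncSeq w N (m - i))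
      (∑ i ∈ Finset.range (m + 1), downMass lam h i * w (m - i)) := by
    have h3 := hasSum_sum_of_ne_finset_zero (L := .unconditional _) (s := Finset.range (m + 1))
      (f := fun i : ℕ => downMass lam h i * truncSeq w N (m - i)) (fun i hi => by
        rw [truncSeq_of_neg _ _ (by simp at hi; omega), mul_zero])
    convert! h3 using 1
    refine Finset.sum_congr rfl fun i hi => ?_
    have hi' : i ≤ m := by simp at hi; omega
    rw [← Nat.cast_sub hi', truncSeq_natCast w (by omega)]
  have h4 := h2.sub (J.hasSum.mul_right (w m))
  have h5 := h1.unique (h4.congr_fun fun i => by ring)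
  have h6 := J.scaleSeq_succ m
  rw [← hw] at h6
  linarith

/-- The ratio of the geometric test function. -/
noncomputable def testRatio (lam : Measure ℝ) (h : ℝ) : ℝ :=
  1 + 2 * lam.real Set.univ / lam.real {h}

lemma IsSkipFreeMeasure.one_le_testRatio (H : IsSkipFreeMeasure lam h) : 1 ≤ testRatio lam h := by
  unfold testRatio
  have := div_nonneg (mul_nonneg zero_le_two (measureReal_nonneg (μ := lam) (s := Set.univ)))
    H.up_pos.le
  linarith

/-- The ratio `θ` is chosen so that the upward jump gains `p θ^m (θ - 1) = 2 c θ^m`, while downward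
jumps lose at most `(c - p) θ^m`. Subtracting `θ ^ N` makes the test function nonpositive without
affecting the generator. -/
lemma IsSkipFreeMeasure.le_latticeGenerator_pow (H : IsSkipFreeMeasure lam h) (N : ℕ) {k : ℤ}
    (hk0 : 0 ≤ k) (hkN : k < N) :
    lam.real Set.univ ≤ latticeGenerator lam h (fun k => truncSeq (testRatio lam h ^ ·) N k -
      testRatio lam h ^ N) k := by
  have J := H.isJumpData
  have hθ := H.one_le_testRatio
  have hpθ : lam.real {h} * (testRatio lam h - 1) = 2 * lam.real Set.univ := by
    have := J.pos.ne'
    unfold testRatio; field_simp; ring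
  set θ := testRatio lam h
  set c := lam.real Set.univ
  set p := lam.real {h}
  have hmono : Monotone fun n : ℕ => θ ^ n := pow_right_mono₀ hθ
  have hnn : ∀ n : ℕ, 0 ≤ θ ^ n := fun n => pow_nonneg (by linarith) n
  obtain ⟨m, rfl⟩ := Int.eq_ofNat_of_zero_le hk0
  have hmN : m + 1 ≤ N := by omega
  have h1 := H.hasSum_latticeGenerator (f := fun k => truncSeq (θ ^ ·) N k - θ ^ N)
    (B := θ ^ N + θ ^ N) (fun k => (abs_sub _ _).trans (add_le_add (abs_truncSeq_le hnn hmono N k)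
      (by rw [abs_of_nonneg (hnn N)]))) m
  have e0 : truncSeq (θ ^ ·) N (m : ℤ) = θ ^ m := truncSeq_natCast (θ ^ ·) (by omega)
  have e1 : truncSeq (θ ^ ·) N ((m : ℤ) + 1) = θ ^ (m + 1) := by
    have := truncSeq_natCast (θ ^ ·) hmN
    push_cast at this; exact this
  simp only [e0, e1, sub_sub_sub_cancel_right] at h1
  have h2 := hasSum_le (L := .unconditional _) (fun i => ?_) (J.hasSum.mul_right (-θ ^ m)) h1
  · have h3 : θ ^ (m + 1) - θ ^ m = θ ^ m * (θ - 1) := by ring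
    rw [h3] at h2
    have h4 : p * (θ ^ m * (θ - 1)) = θ ^ m * (2 * c) := by rw [← hpθ]; ring
    rw [h4] at h2
    have h5 : 1 ≤ θ ^ m := one_le_pow₀ hθ
    have h6 : 0 ≤ c := measureReal_nonneg
    have h7 : 0 ≤ p * θ ^ m := mul_nonneg J.pos.le (hnn m)
    nlinarith
  · refine mul_le_mul_of_nonneg_left ?_ (J.nonneg i)
    have := truncSeq_nonneg hnn N (m - i)
    linarith

end JumpMeasure

/-! ### Exits of right-continuous integer paths, seen on fine grids. -/

section Paths

/-- The `ℤ`-valued path `y` leaves `[0, N)`, and does so upwards. -/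
def ExitsUp (N : ℕ) (y : ℝ≥0 → ℤ) : Prop :=
  ∃ τ, (N : ℤ) ≤ y τ ∧ ∀ s < τ, 0 ≤ y s ∧ y s < N

/-- `ℤ`-valued right-continuous paths. -/
def IsRightConst (y : ℝ≥0 → ℤ) : Prop := ∀ t, ∃ ε > 0, ∀ s, t ≤ s → s < t + ε → y s = y t

variable {y : ℝ≥0 → ℤ} {N : ℕ}

lemma IsRightConst.exit_cases (hy : IsRightConst y) (N : ℕ) :
    (∀ t, 0 ≤ y t ∧ y t < N) ∨
      ∃ τ, ¬ (0 ≤ y τ ∧ y τ < N) ∧ ∀ s < τ, 0 ≤ y s ∧ y s < N := by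
  by_cases hall : ∀ t, 0 ≤ y t ∧ y t < N
  · exact Or.inl hall
  · right
    push Not at hall
    set E : Set ℝ≥0 := {t | ¬ (0 ≤ y t ∧ y t < N)} with hE
    have hne : E.Nonempty := by
      obtain ⟨t, ht⟩ := hall
      exact ⟨t, fun h => absurd h.2 (not_lt.2 (ht h.1))⟩
    have hbdd : BddBelow E := OrderBot.bddBelow E
    refine ⟨sInf E, ?_, fun s hs => ?_⟩
    · intro hin
      obtain ⟨ε, hε, hc⟩ := hy (sInf E)
      obtain ⟨s, hs, hlt⟩ := exists_lt_of_csInf_lt hne (lt_add_of_pos_right (sInf E) hε)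
      have := hc s (csInf_le hbdd hs) hlt
      exact hs (this ▸ hin)
    · by_contra hcon
      exact absurd (csInf_le hbdd hcon) (not_le.2 hs)

lemma exitsUp_iff_of_exit {τ : ℝ≥0} (hτ : ¬ (0 ≤ y τ ∧ y τ < N))
    (hlt : ∀ s < τ, 0 ≤ y s ∧ y s < N) : ExitsUp N y ↔ (N : ℤ) ≤ y τ := by
  refine ⟨?_, fun h => ⟨τ, h, hlt⟩⟩
  rintro ⟨σ, h1, h2⟩
  rcases lt_trichotomy σ τ with h | rfl | h
  · have := (hlt σ h).2; omega
  · exact h1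
  · exact absurd (h2 τ h) hτ

/-- The path keeps its exit value on some `[τ, τ + ε)`. A grid finer than `ε` that extends beyond `τ
+ ε` has a point there, and its earlier points lie before `τ`. -/
lemma IsRightConst.eventually_mem_upSet_iff (hy : IsRightConst y) {δ : ℕ → ℝ≥0} {K : ℕ → ℕ}
    (hδ0 : ∀ m, 0 < δ m) (hδ : Tendsto δ atTop (𝓝 0))
    (hK : Tendsto (fun m => (K m : ℝ≥0) * δ m) atTop atTop) (N : ℕ) :
    ∀ᶠ m in atTop, ((fun j : ℕ => y (j * δ m)) ∈ upSet N (K m) ↔ ExitsUp N y) := by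
  rcases hy.exit_cases N with hall | ⟨τ, hτ, hlt⟩
  · refine Eventually.of_forall fun m => ⟨?_, ?_⟩
    · rintro ⟨j, -, h1, -⟩
      dsimp only at h1
      have := (hall (j * δ m)).2
      omega
    · rintro ⟨σ, h1, -⟩
      have := (hall σ).2
      omega
  · obtain ⟨ε, hε, hc⟩ := hy τ
    filter_upwards [hδ.eventually (gt_mem_nhds hε), hK.eventually_ge_atTop (τ + ε)] with m hm1 hm2
    rw [exitsUp_iff_of_exit hτ hlt]
    have hd := hδ0 m
    -- The first grid time at or after `τ`, hence within `[τ, τ + ε)`.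
    set j := ⌈τ / δ m⌉₊ with hj
    have hj1 : τ ≤ j * δ m := by
      have := Nat.le_ceil (τ / δ m)
      rwa [div_le_iff₀ hd] at this
    have hj2 : (j : ℝ≥0) * δ m < τ + ε := by
      have h1 : (j : ℝ≥0) < τ / δ m + 1 := Nat.ceil_lt_add_one (zero_le)
      have h2 : (j : ℝ≥0) * δ m < (τ / δ m + 1) * δ m := mul_lt_mul_of_pos_right h1 hd
      rw [add_mul, one_mul, div_mul_cancel₀ _ hd.ne'] at h2
      exact h2.trans (by gcongr)
    have hjK : j ≤ K m := by
      have h1 : (j : ℝ≥0) * δ m < K m * δ m := hj2.trans_le hm2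
      have h2 := lt_of_mul_lt_mul_right h1 (zero_le)
      exact_mod_cast h2.le
    have hyj : y (j * δ m) = y τ := hc _ hj1 hj2
    have hbefore : ∀ l < j, 0 ≤ y (l * δ m) ∧ y (l * δ m) < N := by
      intro l hl
      refine hlt _ ?_
      have := Nat.lt_ceil.1 hl
      rwa [lt_div_iff₀ hd] at this
    constructor
    · rintro ⟨i, -, h1, h2⟩
      dsimp only at h1 h2
      rcases lt_trichotomy i j with hij | rfl | hij
      · have := (hbefore i hij).2; omega
      · rwa [hyj] at h1
      · have := h2 j hij
        rw [hyj] at this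
        exact absurd this hτ
    · intro h1
      exact ⟨j, hjK, by simpa only [hyj] using h1, hbefore⟩

end Paths

/-! ### The chain as a lattice path, and its grid increments. -/

section LatticePaths

variable {Ω : Type*} {X : ℝ≥0 → Ω → ℝ} {h : ℝ}

/-- The paths which start at `0` and stay in `ℤ_h`. -/
def IsLatticePath (X : ℝ≥0 → Ω → ℝ) (h : ℝ) (ω : Ω) : Prop :=
  X 0 ω = 0 ∧ ∀ t, X t ω ∈ lattice h

/-- The path `n + X / h`, read in `ℤ`. -/
noncomputable def levelPath (X : ℝ≥0 → Ω → ℝ) (h : ℝ) (n : ℕ) (ω : Ω) (t : ℝ≥0) : ℤ :=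
  n + ⌊X t ω / h⌋

/-- The increments, read in `ℤ`, over the grid of mesh `δ`. -/
noncomputable def gridStep (X : ℝ≥0 → Ω → ℝ) (h : ℝ) (δ : ℝ≥0) (l : ℕ) (ω : Ω) : ℤ :=
  ⌊(X ((l + 1 : ℕ) * δ) ω - X (l * δ) ω) / h⌋

lemma isRightConst_levelPath (hh : 0 < h) {ω : Ω} (hc : IsCadlag fun t => X t ω)
    (hω : IsLatticePath X h ω) (n : ℕ) : IsRightConst (levelPath X h n ω) := by
  intro t
  obtain ⟨ε, hε, hε'⟩ := Metric.continuousWithinAt_iff.1 (hc t).1 h hh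
  refine ⟨⟨ε, hε.le⟩, hε, fun s hts hsε => ?_⟩
  have h1 : dist (X s ω) (X t ω) < h := by
    refine hε' hts ?_
    rw [NNReal.dist_eq, abs_of_nonneg (sub_nonneg.2 (NNReal.coe_le_coe.2 hts))]
    have := NNReal.coe_lt_coe.2 hsε
    change (s : ℝ) < t + ε at this
    linarith
  obtain ⟨a, ha⟩ := hω.2 s
  obtain ⟨b, hb⟩ := hω.2 t
  dsimp only at ha hb
  rw [levelPath, levelPath, ← ha, ← hb, floor_mul_div hh, floor_mul_div hh]
  rw [← ha, ← hb, Real.dist_eq, ← mul_sub, abs_mul, abs_of_pos hh] at h1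
  have h2 : |(a : ℝ) - b| < 1 := by
    by_contra hcon
    exact absurd h1 (not_lt.2 (le_mul_of_one_le_right hh.le (not_lt.1 hcon)))
  have h3 : |a - b| < 1 := by exact_mod_cast h2
  have := abs_lt.1 h3
  omega

lemma walk_gridStep (hh : 0 < h) {ω : Ω} (hω : IsLatticePath X h ω) (n : ℕ) (δ : ℝ≥0) (j : ℕ) :
    walk n (gridStep X h δ · ω) j = levelPath X h n ω (j * δ) := by
  induction j with
  | zero => simp [walk, levelPath, hω.1]
  | succ j ih =>
    rw [walk_succ, ih]
    obtain ⟨a, ha⟩ := hω.2 (j * δ)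
    obtain ⟨b, hb⟩ := hω.2 ((j + 1 : ℕ) * δ)
    dsimp only at ha hb
    rw [levelPath, levelPath, gridStep, ← ha, ← hb, ← mul_sub, ← Int.cast_sub, floor_mul_div hh,
      floor_mul_div hh, floor_mul_div hh]
    ring

variable [MeasurableSpace Ω] {P : Measure Ω} {lam : Measure ℝ}

lemma IsUpwardsSkipFree.isSkipFreeMeasure (hX : IsUpwardsSkipFree P X lam h) :
    IsSkipFreeMeasure lam h :=
  ⟨hX.finite, hX.no_atom_zero, hX.h_pos, hX.support_subset, hX.support_pos⟩

variable (hX : IsUpwardsSkipFree P X lam h)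
include hX

lemma measurable_gridStep (δ : ℝ≥0) (l : ℕ) : Measurable (gridStep X h δ l) :=
  (measurable_floor_div h).comp ((hX.measurable _).sub (hX.measurable _))

lemma iIndepFun_gridStep (δ : ℝ≥0) : iIndepFun (gridStep X h δ) P :=
  (hX.indep.nat (t := fun l : ℕ => (l : ℝ≥0) * δ) (fun a b hab => by
    dsimp only; gcongr)).comp (fun _ x => ⌊x / h⌋) fun _ => measurable_floor_div h

lemma map_gridStep (δ : ℝ≥0) (l : ℕ) :
    P.map (gridStep X h δ l) = (P.map (X δ)).map fun x => ⌊x / h⌋ := by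
  have h1 := (hX.stationary (l * δ) ((l + 1 : ℕ) * δ) (by gcongr; simp)).map_eq
  have h2 : ((l + 1 : ℕ) : ℝ≥0) * δ - l * δ = δ := by
    push_cast; rw [add_mul, one_mul, add_tsub_cancel_left]
  rw [h2] at h1
  have hm : Measurable fun ω => X ((l + 1 : ℕ) * δ) ω - X (l * δ) ω :=
    (hX.measurable _).sub (hX.measurable _)
  rw [← h1, Measure.map_map (measurable_floor_div h) hm]
  rfl

variable [IsProbabilityMeasure P]

lemma map_eq_compoundPoissonLaw (t : ℝ≥0) : P.map (X t) = compoundPoissonLaw lam t := by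
  have := hX.finite
  have := Measure.isProbabilityMeasure_map (hX.measurable t).aemeasurable (μ := P)
  exact eq_compoundPoissonLaw t.2 (hX.charFun_eq t)

lemma ae_apply_mem_lattice (t : ℝ≥0) : ∀ᵐ ω ∂P, X t ω ∈ lattice h := by
  have := Measure.isProbabilityMeasure_map (hX.measurable t).aemeasurable (μ := P)
  have hh := hX.h_pos
  refine ae_of_ae_map (hX.measurable t).aemeasurable
    (ae_mem_lattice_of_charFun_eq_one (μ := P.map (X t)) hh ?_)
  rw [hX.charFun_eq]
  have h1 : ∫ x : ℝ, (Complex.exp (Complex.I * ((2 * Real.pi / h : ℝ) : ℂ) * (x : ℂ)) - 1) ∂lam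
      = 0 := by
    refine integral_eq_zero_of_ae ?_
    filter_upwards [hX.isSkipFreeMeasure.ae_mem_lattice] with x hx
    obtain ⟨k, rfl⟩ := hx
    have h2 := Complex.exp_int_mul_two_pi_mul_I k
    have h3 : Complex.I * ((2 * Real.pi / h : ℝ) : ℂ) * ((h * (k : ℝ) : ℝ) : ℂ) =
        k * (2 * Real.pi * Complex.I) := by
      have : (h : ℂ) ≠ 0 := by exact_mod_cast hh.ne'
      push_cast; field_simp
    simp only [h3, h2, sub_self, Pi.zero_apply]
  rw [h1]; simp

/-- The one-time statement holds simultaneously on a countable dense set of times; right-continuity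
and closedness of the lattice extend it to all times. -/
lemma ae_isLatticePath : ∀ᵐ ω ∂P, IsLatticePath X h ω := by
  obtain ⟨D, hDc, hDd⟩ := TopologicalSpace.exists_countable_dense ℝ≥0
  have h1 : ∀ᵐ ω ∂P, ∀ t ∈ D, X t ω ∈ lattice h :=
    (ae_ball_iff hDc).2 fun t _ => ae_apply_mem_lattice hX t
  filter_upwards [hX.zero, h1] with ω h0 hω
  refine ⟨h0, fun t => ?_⟩
  refine (isClosed_lattice hX.h_pos.ne').mem_of_frequently_of_tendsto ?_ (hX.cadlag ω t).1
  rw [frequently_nhdsWithin_iff]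
  have h2 : t ∈ closure (Set.Ioi t ∩ D) := by
    have h3 := closure_minimal (hDd.open_subset_closure_inter (isOpen_Ioi (a := t)))
      isClosed_closure
    rw [closure_Ioi] at h3
    exact h3 Set.self_mem_Ici
  exact (mem_closure_iff_frequently.1 h2).mono fun s hs => ⟨hω s hs.2, Set.Ioi_subset_Ici_self hs.1⟩

lemma abs_integral_gridStep_sub_le {δ : ℝ≥0} (hδ : δ * lam.real Set.univ ≤ 1) {f : ℤ → ℝ} {B : ℝ}
    (hB : ∀ k, |f k| ≤ B) (k : ℤ) :
    |∫ x, (f (k + x) - f k) ∂(P.map (X δ)).map (fun x => ⌊x / h⌋) -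
      δ * latticeGenerator lam h f k| ≤ 3 * B * (δ * lam.real Set.univ) ^ 2 := by
  have := hX.finite
  have := Measure.isProbabilityMeasure_map (hX.measurable δ).aemeasurable (μ := P)
  have hfm : Measurable f := measurable_from_top
  have hgm : Measurable fun x : ℝ => f (k + ⌊x / h⌋) :=
    hfm.comp ((measurable_floor_div h).const_add k)
  have h1 := abs_integral_compoundPoissonLaw_sub_le (lam := lam) δ.2 hδ hgm
    (fun x => hB (k + ⌊x / h⌋))
  rw [integral_map (measurable_floor_div h).aemeasurable
    (measurable_from_top (f := fun x : ℤ => f (k + x) - f k)).aestronglyMeasurable,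
    integral_sub (Integrable.of_bound hgm.aestronglyMeasurable B
      (Eventually.of_forall fun x => hB _)) (integrable_const _), map_eq_compoundPoissonLaw hX]
  rw [map_eq_compoundPoissonLaw hX] at this
  simpa [latticeGenerator] using h1

end LatticePaths

/-! ### The exit probability by time discretization. -/

section ExitProbability

section Mesh

/-- The mesh of the grids by which paths are approximated. -/
noncomputable def mesh (m : ℕ) : ℝ≥0 := ((m + 1 : ℝ≥0) ^ 2)⁻¹

/-- The number of points of these grids. -/
def gridSize (m : ℕ) : ℕ := (m + 1) ^ 3

lemma mesh_pos (m : ℕ) : 0 < mesh m := by unfold mesh; positivity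

lemma coe_mesh (m : ℕ) : (mesh m : ℝ) = ((m + 1 : ℝ) ^ 2)⁻¹ := by simp [mesh]

lemma gridSize_mul_mesh (m : ℕ) : (gridSize m : ℝ≥0) * mesh m = m + 1 := by
  unfold gridSize mesh
  push_cast
  field_simp

lemma gridSize_mul_mesh_real (m : ℕ) : (gridSize m : ℝ) * mesh m = m + 1 := by
  exact_mod_cast congrArg NNReal.toReal (gridSize_mul_mesh m)

/-- The reason for the exponents `2` and `3`: the horizon `m + 1` diverges while the accumulated
quadratic error vanishes. -/
lemma gridSize_mul_mesh_sq (m : ℕ) : (gridSize m : ℝ) * (mesh m : ℝ) ^ 2 = 1 / (m + 1) := by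
  rw [coe_mesh]; unfold gridSize
  push_cast
  field_simp

lemma tendsto_mesh : Tendsto mesh atTop (𝓝 0) := by
  rw [← NNReal.tendsto_coe]
  have h := tendsto_one_div_add_atTop_nhds_zero_nat (𝕜 := ℝ)
  have h2 := h.pow 2
  simp only [ne_eq, OfNat.ofNat_ne_zero, not_false_eq_true, zero_pow] at h2
  refine h2.congr fun m => ?_
  rw [coe_mesh]; simp

lemma tendsto_gridSize_mul_mesh : Tendsto (fun m => (gridSize m : ℝ≥0) * mesh m) atTop atTop := by
  simp_rw [gridSize_mul_mesh]
  exact tendsto_atTop_mono (fun m => le_self_add) tendsto_natCast_atTop_atTop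

end Mesh

lemma IsSkipFreeMeasure.total_mass_pos {lam : Measure ℝ} {h : ℝ} (H : IsSkipFreeMeasure lam h) :
    0 < lam.real Set.univ :=
  H.up_pos.trans_le H.isJumpData.le_total

variable {Ω : Type*} [MeasurableSpace Ω] {P : Measure Ω} {X : ℝ≥0 → Ω → ℝ} {lam : Measure ℝ}
  {h : ℝ} (hX : IsUpwardsSkipFree P X lam h) [IsProbabilityMeasure P]
include hX

lemma tendsto_alive_probability (n N : ℕ) :
    Tendsto (fun m => P.real {ω | walk n (gridStep X h (mesh m) · ω) ∈ aliveSet N (gridSize m)})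
      atTop (𝓝 0) := by
  have H := hX.isSkipFreeMeasure
  have hc := H.total_mass_pos
  set c := lam.real Set.univ with hcdef
  set θ := testRatio lam h with hθdef
  have hθ : 1 ≤ θ := H.one_le_testRatio
  have hmono : Monotone fun n : ℕ => θ ^ n := pow_right_mono₀ hθ
  have hnn : ∀ n : ℕ, 0 ≤ θ ^ n := fun n => pow_nonneg (by linarith) n
  set B := θ ^ N with hBdef
  have hB1 : 0 < B := pow_pos (by linarith) N
  set g : ℤ → ℝ := fun k => truncSeq (θ ^ ·) N k - θ ^ N with hg
  have hg0 : ∀ k, g k ≤ 0 := fun k => sub_nonpos.2 (truncSeq_le hnn hmono N k)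
  have hgB : ∀ k, |g k| ≤ B := fun k => by
    rw [abs_of_nonpos (hg0 k)]
    have := truncSeq_nonneg hnn N k
    simp only [hg]; linarith
  have hδ : Tendsto (fun m => (mesh m : ℝ)) atTop (𝓝 0) :=
    (NNReal.tendsto_coe (x := 0)).2 tendsto_mesh
  have hbound : ∀ᶠ m : ℕ in atTop,
      P.real {ω | walk n (gridStep X h (mesh m) · ω) ∈ aliveSet N (gridSize m)} ≤
        2 * B / c * (1 / ((m : ℝ) + 1)) := by
    -- The first threshold validates the small-time expansion. The second makes its error at most
    -- half of the drift `mesh m * c`, leaving `η = mesh m * c / 2`.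
    filter_upwards [hδ.eventually (gt_mem_nhds (show 0 < 1 / c by positivity)),
      hδ.eventually (gt_mem_nhds (show 0 < 1 / (6 * B * c) by positivity))] with m h1 h2
    have hδ0 : (0 : ℝ) < mesh m := NNReal.coe_pos.2 (mesh_pos m)
    have h3 : (mesh m : ℝ) * c ≤ 1 := ((lt_div_iff₀ hc).1 h1).le
    have h4 : (mesh m : ℝ) * (6 * B * c) ≤ 1 := ((lt_div_iff₀ (by positivity)).1 h2).le
    have h5 := mul_alive_probability_le (P := P) (n := n) (N := N) (iIndepFun_gridStep hX (mesh m))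
      (measurable_gridStep hX (mesh m)) (map_gridStep hX (mesh m)) hg0 hgB
      (η := mesh m * c / 2) (by positivity) (fun k hk0 hkN => ?_) (gridSize m)
    · have h6 := gridSize_mul_mesh_real m
      set p := P.real {ω | walk n (gridStep X h (mesh m) · ω) ∈ aliveSet N (gridSize m)}
      have h7 : (gridSize m : ℝ) * (mesh m * c / 2 * p) = (m + 1) * c / 2 * p := by
        rw [← h6]; ring
      rw [h7] at h5
      have h8 : 2 * B / c * (1 / ((m : ℝ) + 1)) = B / ((m + 1) * c / 2) := by
        field_simp
      rw [h8, le_div_iff₀ (by positivity)]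
      linarith
    · have h6 := abs_integral_gridStep_sub_le hX h3 hgB k
      have h7 := H.le_latticeGenerator_pow N hk0 hkN
      have h8 : (mesh m : ℝ) * c ≤ mesh m * latticeGenerator lam h g k :=
        mul_le_mul_of_nonneg_left h7 hδ0.le
      have h9 : 3 * B * ((mesh m : ℝ) * c) ^ 2 ≤ mesh m * c / 2 := by
        have := mul_le_mul_of_nonneg_right h4 (show 0 ≤ (mesh m : ℝ) * c / 2 by positivity)
        linarith [this, show (mesh m : ℝ) * (6 * B * c) * (mesh m * c / 2) =
          3 * B * ((mesh m : ℝ) * c) ^ 2 by ring]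
      have h10 := (abs_le.1 h6).1
      linarith
  refine squeeze_zero' (Eventually.of_forall fun m => measureReal_nonneg) hbound ?_
  simpa using (tendsto_one_div_add_atTop_nhds_zero_nat (𝕜 := ℝ)).const_mul (2 * B / c)

lemma tendsto_up_probability {n N : ℕ} (hn : n < N) :
    Tendsto (fun m => P.real {ω | walk n (gridStep X h (mesh m) · ω) ∈ upSet N (gridSize m)} *
      latticeScale lam h N) atTop (𝓝 (latticeScale lam h n)) := by
  have H := hX.isSkipFreeMeasure
  have J := H.isJumpData
  have hc := H.total_mass_pos
  set c := lam.real Set.univ with hcdef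
  set w := latticeScale lam h with hw
  have hnn : ∀ n, 0 ≤ w n := fun n => (J.scaleSeq_pos n).le
  have hmono : Monotone w := J.scaleSeq_mono
  have hδ : Tendsto (fun m => (mesh m : ℝ)) atTop (𝓝 0) :=
    (NNReal.tendsto_coe (x := 0)).2 tendsto_mesh
  have hbound : ∀ᶠ m : ℕ in atTop,
      ‖P.real {ω | walk n (gridStep X h (mesh m) · ω) ∈ upSet N (gridSize m)} * w N - w n‖ ≤
        3 * w N * c ^ 2 * (1 / ((m : ℝ) + 1)) +
          w N * P.real {ω | walk n (gridStep X h (mesh m) · ω) ∈ aliveSet N (gridSize m)} := by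
    filter_upwards [hδ.eventually (gt_mem_nhds (show 0 < 1 / c by positivity))] with m h1
    have h3 : (mesh m : ℝ) * c ≤ 1 := ((lt_div_iff₀ hc).1 h1).le
    have h5 := abs_up_probability_sub_le (P := P) (iIndepFun_gridStep hX (mesh m))
      (measurable_gridStep hX (mesh m)) (map_gridStep hX (mesh m)) (f := truncSeq w N) hn
      (fun k hk => truncSeq_of_neg w N hk) (fun k hk => truncSeq_of_le w N hk)
      (abs_truncSeq_le hnn hmono N) (ε := 3 * w N * (mesh m * c) ^ 2)
      (mul_nonneg (mul_nonneg zero_le_three (hnn N)) (sq_nonneg _)) (fun k hk0 hkN => ?_)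
      (gridSize m)
    · rw [truncSeq_natCast w le_rfl, truncSeq_natCast w hn.le] at h5
      have h6 := gridSize_mul_mesh_sq m
      have h7 : (gridSize m : ℝ) * (3 * w N * (mesh m * c) ^ 2) =
          3 * w N * c ^ 2 * (1 / ((m : ℝ) + 1)) := by rw [← h6]; ring
      rw [h7] at h5
      exact h5
    · have h6 := abs_integral_gridStep_sub_le hX h3 (abs_truncSeq_le hnn hmono N) k
      rwa [H.latticeGenerator_scale N hk0 hkN, mul_zero, sub_zero] at h6
  rw [tendsto_iff_norm_sub_tendsto_zero]
  refine squeeze_zero' (Eventually.of_forall fun m => norm_nonneg _) hbound ?_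
  have h1 := (tendsto_one_div_add_atTop_nhds_zero_nat (𝕜 := ℝ)).const_mul (3 * w N * c ^ 2)
  have h2 := (tendsto_alive_probability hX n N).const_mul (w N)
  simpa using h1.add h2

lemma ae_exits (n N : ℕ) : ∀ᵐ ω ∂P, ∃ τ, ¬ (0 ≤ levelPath X h n ω τ ∧ levelPath X h n ω τ < N) := by
  have hgood := ae_isLatticePath hX
  have hle : ∀ m, P.real {ω | ∀ t, 0 ≤ levelPath X h n ω t ∧ levelPath X h n ω t < N} ≤
      P.real {ω | walk n (gridStep X h (mesh m) · ω) ∈ aliveSet N (gridSize m)} := by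
    intro m
    refine ENNReal.toReal_mono (measure_ne_top _ _) (measure_mono_ae ?_)
    filter_upwards [hgood] with ω hω hmem
    intro j _
    rw [walk_gridStep hX.h_pos hω]
    exact hmem _
  have h0 : P.real {ω | ∀ t, 0 ≤ levelPath X h n ω t ∧ levelPath X h n ω t < N} = 0 :=
    le_antisymm (ge_of_tendsto' (tendsto_alive_probability hX n N) hle) measureReal_nonneg
  have h1 := (measureReal_eq_zero_iff (measure_ne_top _ _)).1 h0
  have h2 := measure_eq_zero_iff_ae_notMem.1 h1
  filter_upwards [h2] with ω hω
  by_contra hcon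
  push Not at hcon
  exact hω fun t => hcon t

/-- Almost surely the measurable grid events eventually agree with the exit event. This gives null
measurability and identifies its probability as the limit of the grid probabilities. -/
lemma nullMeasurableSet_exitsUp_and_probability {n N : ℕ} (hn : n ≤ N) :
    NullMeasurableSet {ω | ExitsUp N (levelPath X h n ω)} P ∧
      P.real {ω | ExitsUp N (levelPath X h n ω)} = latticeScale lam h n / latticeScale lam h N := by
  have hgood := ae_isLatticePath hX
  have hwN : latticeScale lam h N ≠ 0 := (hX.isSkipFreeMeasure.isJumpData.scaleSeq_pos N).ne'
  rcases hn.eq_or_lt with rfl | hn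
  -- A path started at the upper boundary exits at time `0`; the walk estimates need a start inside.
  · have h1 : {ω | ExitsUp n (levelPath X h n ω)} =ᵐ[P] Set.univ := by
      filter_upwards [hgood] with ω hω
      refine eq_true ⟨0, ?_, fun s hs => absurd hs not_lt_zero⟩
      simp [levelPath, hω.1]
    refine ⟨nullMeasurableSet_univ.congr h1.symm, ?_⟩
    rw [measureReal_congr h1, div_self hwN, probReal_univ]
  · have hlim : ∀ᵐ ω ∂P, ∀ᶠ m in atTop,
        ω ∈ {ω | walk n (gridStep X h (mesh m) · ω) ∈ upSet N (gridSize m)} ↔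
        ω ∈ {ω | ExitsUp N (levelPath X h n ω)} := by
      filter_upwards [hgood] with ω hω
      have h1 := (isRightConst_levelPath hX.h_pos (hX.cadlag ω) hω n).eventually_mem_upSet_iff
        mesh_pos tendsto_mesh tendsto_gridSize_mul_mesh N
      filter_upwards [h1] with m hm
      rw [← funext (walk_gridStep hX.h_pos hω n (mesh m))] at hm
      exact hm
    have hmeas : ∀ m, MeasurableSet
        {ω | walk n (gridStep X h (mesh m) · ω) ∈ upSet N (gridSize m)} := fun m =>
      measurable_walk_comp (measurable_gridStep hX (mesh m)) n (measurableSet_upSet N _)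
    have hnull := nullMeasurableSet_of_tendsto_indicator atTop
      (fun m => (hmeas m).nullMeasurableSet) hlim
    refine ⟨hnull, ?_⟩
    obtain ⟨A, -, hAm, hA⟩ := hnull.exists_measurable_superset_ae_eq
    have h1 := tendsto_measure_of_ae_tendsto_indicator_of_isFiniteMeasure atTop hAm hmeas (by
      filter_upwards [hlim, hA.mem_iff] with ω h1 h2
      filter_upwards [h1] with m hm
      rw [hm, h2])
    have h2 := (ENNReal.tendsto_toReal (measure_ne_top P A)).comp h1
    have h3 := h2.mul_const (latticeScale lam h N)
    have h4 := tendsto_nhds_unique h3 (tendsto_up_probability hX hn)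
    rw [measure_congr hA] at h4
    rw [eq_div_iff hwN]
    exact h4

end ExitProbability

/-! ### Running infimum and excursion depth as exit events. -/

section ExitEvents

section HittingTimes

variable {Ω : Type*} {X : ℝ≥0 → Ω → ℝ} {ω : Ω} {y : ℝ} {τ : ℝ≥0}

lemma entranceTime_eq (h1 : y ≤ X τ ω) (h2 : ∀ s < τ, X s ω < y) : entranceTime X y ω = τ := by
  unfold entranceTime hittingAfter
  rw [if_pos ⟨τ, zero_le, h1⟩]
  congr 1
  refine le_antisymm (csInf_le (OrderBot.bddBelow _) ⟨zero_le, h1⟩)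
    (le_csInf ⟨τ, zero_le, h1⟩ fun s hs => ?_)
  by_contra hcon
  exact absurd hs.2 (not_le.2 (h2 s (not_le.1 hcon)))

lemma le_entranceTime (h : ∀ s < τ, X s ω < y) : (τ : WithTop ℝ≥0) ≤ entranceTime X y ω := by
  unfold entranceTime hittingAfter
  split_ifs with hex
  · rw [WithTop.coe_le_coe]
    refine le_csInf hex fun s hs => ?_
    by_contra hcon
    exact absurd hs.2 (not_le.2 (h s (not_le.1 hcon)))
  · exact le_top

variable {h : ℝ} {n N : ℕ} {x : ℝ}

/-- The closed range of times serves the running infimum, the half-open one the excursion depth.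
They agree because at the entrance time itself the path is at or above `y ≥ -x`. -/
lemma exitsUp_levelPath_iff (hrc : IsRightConst (levelPath X h n ω))
    (hex : ∃ τ, ¬ (0 ≤ levelPath X h n ω τ ∧ levelPath X h n ω τ < N))
    (hlo : ∀ t, 0 ≤ levelPath X h n ω t ↔ -x ≤ X t ω)
    (hup : ∀ t, levelPath X h n ω t < N ↔ X t ω < y) (hxy : -x ≤ y) :
    (ExitsUp N (levelPath X h n ω) ↔
      ∀ s : ℝ≥0, (s : WithTop ℝ≥0) ≤ entranceTime X y ω → -x ≤ X s ω) ∧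
    (ExitsUp N (levelPath X h n ω) ↔
      ∀ s : ℝ≥0, (s : WithTop ℝ≥0) < entranceTime X y ω → -x ≤ X s ω) := by
  rcases hrc.exit_cases N with hall | ⟨τ, hτ, hlt⟩
  · obtain ⟨τ, hτ⟩ := hex
    exact absurd (hall τ) hτ
  rw [exitsUp_iff_of_exit hτ hlt]
  by_cases hN : (N : ℤ) ≤ levelPath X h n ω τ
  · have hy : y ≤ X τ ω := not_lt.1 fun h => absurd ((hup τ).2 h) (not_lt.2 hN)
    have hT : entranceTime X y ω = τ := entranceTime_eq hy fun s hs => (hup s).1 (hlt s hs).2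
    rw [hT]
    refine ⟨⟨fun _ s hs => ?_, fun _ => hN⟩, ⟨fun _ s hs => ?_, fun _ => hN⟩⟩
    · rcases (WithTop.coe_le_coe.1 hs).eq_or_lt with rfl | hs
      · exact hxy.trans hy
      · exact (hlo s).1 (hlt s hs).1
    · exact (hlo s).1 (hlt s (WithTop.coe_lt_coe.1 hs)).1
  · have hneg : X τ ω < -x := not_le.1 fun h => hτ ⟨(hlo τ).2 h, not_le.1 hN⟩
    obtain ⟨ε, hε, hc⟩ := hrc τ
    -- After a downward exit the path rests for a while, so `y` is entered strictly later and `τ`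
    -- belongs even to the half-open range.
    have hlt' : (τ : WithTop ℝ≥0) < entranceTime X y ω := by
      refine lt_of_lt_of_le (WithTop.coe_lt_coe.2 (lt_add_of_pos_right τ hε))
        (le_entranceTime fun s hs => (hup s).1 ?_)
      rcases lt_or_ge s τ with hsτ | hsτ
      · exact (hlt s hsτ).2
      · rw [hc s hsτ hs]; exact not_le.1 hN
    exact ⟨⟨fun h => absurd h hN, fun h => absurd (h τ hlt'.le) (not_le.2 hneg)⟩,
      ⟨fun h => absurd h hN, fun h => absurd (h τ hlt') (not_le.2 hneg)⟩⟩

lemma levelPath_nonneg_iff (hh : 0 < h) (hω : IsLatticePath X h ω) (hx : 0 ≤ x)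
    (hn : n = ⌊x / h⌋₊) (t : ℝ≥0) : 0 ≤ levelPath X h n ω t ↔ -x ≤ X t ω := by
  obtain ⟨k, hk⟩ := hω.2 t
  dsimp only at hk
  rw [levelPath, ← hk, floor_mul_div hh, hn, Int.natCast_floor_eq_floor (div_nonneg hx hh.le)]
  rw [← neg_le_iff_add_nonneg, Int.le_floor, le_div_iff₀ hh]
  push_cast
  constructor <;> intro h1 <;> linarith

lemma levelPath_lt_iff (hh : 0 < h) (hω : IsLatticePath X h ω) (m : ℕ) (t : ℝ≥0) :
    levelPath X h n ω t < ((n + m : ℕ) : ℤ) ↔ X t ω < h * m := by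
  obtain ⟨k, hk⟩ := hω.2 t
  dsimp only at hk
  rw [levelPath, ← hk, floor_mul_div hh, mul_lt_mul_iff_of_pos_left hh]
  have : ((k : ℝ) < (m : ℝ)) ↔ k < (m : ℤ) := by exact_mod_cast Iff.rfl
  rw [this]
  push_cast
  omega

end HittingTimes

variable {Ω : Type*} [MeasurableSpace Ω] {P : Measure Ω} {X : ℝ≥0 → Ω → ℝ} {lam : Measure ℝ}
  {h : ℝ} (hX : IsUpwardsSkipFree P X lam h) [IsProbabilityMeasure P]
include hX

lemma le_runningInf_ae_eq {x : ℝ} (hx : 0 ≤ x) (m : ℕ) :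
    {ω | ((-x : ℝ) : EReal) ≤ runningInf X (entranceTime X (h * m) ω) ω} =ᵐ[P]
      {ω | ExitsUp (⌊x / h⌋₊ + m) (levelPath X h ⌊x / h⌋₊ ω)} := by
  have hh := hX.h_pos
  filter_upwards [ae_isLatticePath hX, ae_exits hX ⌊x / h⌋₊ (⌊x / h⌋₊ + m)] with ω hω hex
  have h1 := (exitsUp_levelPath_iff (isRightConst_levelPath hh (hX.cadlag ω) hω ⌊x / h⌋₊) hex
    (levelPath_nonneg_iff hh hω hx rfl) (levelPath_lt_iff hh hω m)
    (by have := mul_nonneg hh.le (Nat.cast_nonneg (α := ℝ) m); linarith)).1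
  refine propext (Iff.trans ?_ h1.symm)
  change ((-x : ℝ) : EReal) ≤ runningInf X (entranceTime X (h * m) ω) ω ↔ _
  unfold runningInf
  rw [le_iInf₂_iff]
  exact forall₂_congr fun s _ => EReal.coe_le_coe_iff

lemma excursionDepth_le_ae_eq (n : ℕ) :
    {ω | excursionDepth X h 1 ω ≤ ((n * h : ℝ) : EReal)} =ᵐ[P]
      {ω | ExitsUp (n + 1) (levelPath X h n ω)} := by
  have hh := hX.h_pos
  have hn : n = ⌊(n * h : ℝ) / h⌋₊ := by rw [mul_div_cancel_right₀ _ hh.ne', Nat.floor_natCast]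
  have hnh : (0 : ℝ) ≤ n * h := mul_nonneg (Nat.cast_nonneg _) hh.le
  filter_upwards [ae_isLatticePath hX, ae_exits hX n (n + 1)] with ω hω hex
  have h1 := (exitsUp_levelPath_iff (y := h) (isRightConst_levelPath hh (hX.cadlag ω) hω n) hex
    (levelPath_nonneg_iff hh hω hnh hn)
    (fun t => by simpa using levelPath_lt_iff hh hω (n := n) 1 t) (by linarith)).2
  refine propext (Iff.trans ?_ h1.symm)
  change excursionDepth X h 1 ω ≤ ((n * h : ℝ) : EReal) ↔ _
  have h0 : entranceTime X 0 ω = ((0 : ℝ≥0) : WithTop ℝ≥0) :=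
    entranceTime_eq hω.1.ge fun s hs => absurd hs not_lt_zero
  unfold excursionDepth
  simp only [Nat.cast_one, sub_self, zero_mul, one_mul, h0, WithTop.coe_ne_top, if_false,
    EReal.coe_zero, zero_sub]
  rw [EReal.neg_le, ← EReal.coe_neg, le_iInf₂_iff]
  refine forall_congr' fun s => ?_
  simp only [EReal.coe_le_coe_iff]
  exact ⟨fun h2 hs => h2 ⟨WithTop.coe_le_coe.2 zero_le, hs⟩, fun h2 hs => h2 hs.2⟩

lemma excursionDepth_probability (n : ℕ) :
    P.real {ω | excursionDepth X h 1 ω ≤ ((n * h : ℝ) : EReal)} =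
      latticeScale lam h n / latticeScale lam h (n + 1) := by
  rw [measureReal_congr (excursionDepth_le_ae_eq hX n)]
  exact (nullMeasurableSet_exitsUp_and_probability hX (Nat.le_succ n)).2

lemma nullMeasurableSet_excursionDepth (n : ℕ) :
    NullMeasurableSet {ω | excursionDepth X h 1 ω ≤ ((n * h : ℝ) : EReal)} P :=
  (nullMeasurableSet_exitsUp_and_probability hX (Nat.le_succ n)).1.congr
    (excursionDepth_le_ae_eq hX n).symm

/-- The ratios are probabilities of events that increase with the permitted depth. -/
lemma monotone_latticeScale_ratio :
    Monotone fun n => latticeScale lam h n / latticeScale lam h (n + 1) := by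
  intro a b hab
  simp only [← excursionDepth_probability hX]
  refine measureReal_mono fun ω hω => ?_
  refine le_trans (b := ((a * h : ℝ) : EReal)) hω ?_
  rw [EReal.coe_le_coe_iff]
  exact mul_le_mul_of_nonneg_right (by exact_mod_cast hab) hX.h_pos.le

lemma scaleFunction_eq (x : ℝ) : scaleFunction P X h x = latticeScale lam h ⌊x / h⌋₊ := by
  have J := hX.isSkipFreeMeasure.isJumpData
  have hprod : ∀ n : ℕ, ∏ r ∈ Finset.Icc 1 n,
      P.real {ω | excursionDepth X h 1 ω ≤ ((((r : ℝ) - 1) * h : ℝ) : EReal)} =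
      1 / latticeScale lam h n := by
    intro n
    induction n with
    | zero => simp [latticeScale, scaleSeq_zero]
    | succ n ih =>
      rw [Finset.prod_Icc_succ_top (by omega), ih]
      have h1 := excursionDepth_probability hX n
      have h2 : (((n + 1 : ℕ) : ℝ) - 1) * h = n * h := by push_cast; ring
      rw [h2, h1]
      have h3 : latticeScale lam h n ≠ 0 := (J.scaleSeq_pos n).ne'
      field_simp
  rw [scaleFunction, hprod, one_div_one_div]

end ExitEvents

/-! ### Uniqueness of Laplace transforms. -/

section LaplaceUniqueness

/-- Finite measures on `ℝ` whose moment generating functions are finite and agree on `(-∞, 1)`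
are equal. -/
lemma measure_eq_of_mgf_eq {μ ν : Measure ℝ} [IsFiniteMeasure μ] [IsFiniteMeasure ν]
    (hμ : Set.Iio 1 ⊆ integrableExpSet id μ) (hν : Set.Iio 1 ⊆ integrableExpSet id ν)
    (h : ∀ t < 1, mgf id μ t = mgf id ν t) : μ = ν := by
  have hsub : ∀ {ρ : Measure ℝ}, Set.Iio 1 ⊆ integrableExpSet id ρ →
      AnalyticOnNhd ℂ (complexMGF id ρ) {z | z.re < 1} := fun hρ z hz =>
    analyticOnNhd_complexMGF z (interior_maximal hρ isOpen_Iio hz)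
  -- Agreement at the real points `-1 / (n + 1)`, which accumulate at `0`, propagates to the
  -- half-plane. It contains the imaginary axis, where the characteristic functions are read off.
  have heq : Set.EqOn (complexMGF id μ) (complexMGF id ν) {z | z.re < 1} := by
    refine AnalyticOnNhd.eqOn_of_preconnected_of_frequently_eq (hsub hμ) (hsub hν)
      (convex_halfSpace_re_lt 1).isPreconnected (z₀ := 0) (by simp) ?_
    rw [frequently_iff_seq_forall]
    refine ⟨fun n : ℕ => ((-(1 / ((n : ℝ) + 1)) : ℝ) : ℂ), ?_, fun n => ?_⟩
    · rw [tendsto_nhdsWithin_iff]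
      constructor
      · rw [← Complex.ofReal_zero, tendsto_ofReal_iff, ← neg_zero]
        exact (tendsto_one_div_add_atTop_nhds_zero_nat (𝕜 := ℝ)).neg
      · refine Eventually.of_forall fun n => ?_
        have h1 : (-(1 / ((n : ℝ) + 1)) : ℝ) ≠ 0 := neg_ne_zero.2 (by positivity)
        simpa only [Set.mem_compl_iff, Set.mem_singleton_iff, Complex.ofReal_eq_zero] using h1
    · rw [complexMGF_ofReal, complexMGF_ofReal]
      refine congrArg _ (h _ ?_)
      have : 0 < 1 / ((n : ℝ) + 1) := by positivity
      linarith
  refine Measure.ext_of_charFun (funext fun t => ?_)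
  rw [← complexMGF_id_mul_I, ← complexMGF_id_mul_I]
  exact heq (by simp)

variable {f g : ℝ → ℝ} {b : ℝ}

/-- The exponentially tilted measure with density `f` on `(0, ∞)`. -/
noncomputable def tiltedMeasure (f : ℝ → ℝ) (a : ℝ) : Measure ℝ :=
  (volume.restrict (Set.Ioi 0)).withDensity fun x => ENNReal.ofReal (Real.exp (-a * x) * f x)

/-- Tilting by `b + 1` makes the measure finite and matches `t < 1` with `β = b + 1 - t > b`. -/
lemma integrableOn_and_integral_tiltedMeasure (hf : ∀ x, 0 ≤ x → 0 ≤ f x)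
    (hfi : ∀ β, b < β → IntegrableOn (fun x => Real.exp (-β * x) * f x) (Set.Ioi 0))
    {t : ℝ} (ht : t < 1) :
    Integrable (fun x => Real.exp (t * x)) (tiltedMeasure f (b + 1)) ∧
      ∫ x, Real.exp (t * x) ∂tiltedMeasure f (b + 1) =
        ∫ x in Set.Ioi (0 : ℝ), Real.exp (-(b + 1 - t) * x) * f x := by
  have hm : AEMeasurable (fun x => ENNReal.ofReal (Real.exp (-(b + 1) * x) * f x))
      (volume.restrict (Set.Ioi 0)) :=
    (hfi (b + 1) (by linarith)).aestronglyMeasurable.aemeasurable.ennreal_ofReal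
  have htop : ∀ᵐ x ∂volume.restrict (Set.Ioi (0 : ℝ)),
      ENNReal.ofReal (Real.exp (-(b + 1) * x) * f x) < ∞ :=
    Eventually.of_forall fun x => ENNReal.ofReal_lt_top
  have hcongr : (fun x => (ENNReal.ofReal (Real.exp (-(b + 1) * x) * f x)).toReal •
      Real.exp (t * x)) =ᵐ[volume.restrict (Set.Ioi 0)]
      fun x => Real.exp (-(b + 1 - t) * x) * f x := by
    filter_upwards [ae_restrict_mem measurableSet_Ioi] with x hx
    rw [ENNReal.toReal_ofReal (mul_nonneg (Real.exp_pos _).le (hf x (le_of_lt hx))), smul_eq_mul,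
      mul_right_comm, ← Real.exp_add]
    congr 2; ring
  constructor
  · rw [tiltedMeasure, integrable_withDensity_iff_integrable_smul₀' hm htop,
      integrable_congr hcongr]
    exact hfi _ (by linarith)
  · rw [tiltedMeasure, integral_withDensity_eq_integral_toReal_smul₀ hm htop]
    exact integral_congr_ae hcongr

lemma eq_of_laplace_eq (hf : ∀ x, 0 ≤ x → 0 ≤ f x) (hg : ∀ x, 0 ≤ x → 0 ≤ g x)
    (hfr : RightContinuous f) (hgr : RightContinuous g)
    (hfi : ∀ β, b < β → IntegrableOn (fun x => Real.exp (-β * x) * f x) (Set.Ioi 0))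
    (hgi : ∀ β, b < β → IntegrableOn (fun x => Real.exp (-β * x) * g x) (Set.Ioi 0))
    (hfg : ∀ β, b < β → ∫ x in Set.Ioi (0 : ℝ), Real.exp (-β * x) * f x =
      ∫ x in Set.Ioi (0 : ℝ), Real.exp (-β * x) * g x) {x : ℝ} (hx : 0 ≤ x) : f x = g x := by
  have hfin : ∀ {u : ℝ → ℝ}, (∀ x, 0 ≤ x → 0 ≤ u x) →
      (∀ β, b < β → IntegrableOn (fun x => Real.exp (-β * x) * u x) (Set.Ioi 0)) →
      IsFiniteMeasure (tiltedMeasure u (b + 1)) := fun hu hui => by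
    have := (integrableOn_and_integral_tiltedMeasure hu hui zero_lt_one).1
    simpa [integrable_const_iff, isFiniteMeasure_iff] using this
  have := hfin hf hfi
  have := hfin hg hgi
  have hmeas : tiltedMeasure f (b + 1) = tiltedMeasure g (b + 1) := by
    refine measure_eq_of_mgf_eq
      (fun t ht => (integrableOn_and_integral_tiltedMeasure hf hfi ht).1)
      (fun t ht => (integrableOn_and_integral_tiltedMeasure hg hgi ht).1) fun t ht => ?_
    have h1 := (integrableOn_and_integral_tiltedMeasure hf hfi ht).2
    have h2 := (integrableOn_and_integral_tiltedMeasure hg hgi ht).2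
    rw [hfg _ (by linarith), ← h2] at h1
    exact h1
  have hae : ∀ᵐ x ∂volume.restrict (Set.Ioi (0 : ℝ)), f x = g x := by
    have h1 := (withDensity_eq_iff_of_sigmaFinite
      (hfi (b + 1) (by linarith)).aestronglyMeasurable.aemeasurable.ennreal_ofReal
      (hgi (b + 1) (by linarith)).aestronglyMeasurable.aemeasurable.ennreal_ofReal).1 hmeas
    filter_upwards [h1, ae_restrict_mem measurableSet_Ioi] with x h2 hx
    have hx0 : (0 : ℝ) ≤ x := le_of_lt hx
    rw [ENNReal.ofReal_eq_ofReal_iff (mul_nonneg (Real.exp_pos _).le (hf x hx0))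
      (mul_nonneg (Real.exp_pos _).le (hg x hx0))] at h2
    exact mul_left_cancel₀ (Real.exp_pos _).ne' h2
  -- Otherwise `f` and `g` differ on a whole interval `(x, u)`, which has positive measure.
  -- Right-continuity then transfers the equality to `x`.
  have hfreq : ∃ᶠ y in 𝓝[>] x, f y - g y ∈ ({0} : Set ℝ) := by
    intro hev
    obtain ⟨u, hu, hsub⟩ := mem_nhdsGT_iff_exists_Ioo_subset.1 hev
    have h0 : (volume.restrict (Set.Ioi (0 : ℝ))) {y | ¬ f y = g y} = 0 := hae
    have h1 : (volume.restrict (Set.Ioi (0 : ℝ))) (Set.Ioo x u) = 0 := by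
      refine measure_mono_null (fun y hy => ?_) h0
      have h2 := hsub hy
      intro h3
      exact h2 (by simp [h3])
    have h4 : Set.Ioo x u ⊆ Set.Ioi 0 := fun y hy => hx.trans_lt hy.1
    rw [Measure.restrict_apply measurableSet_Ioo, Set.inter_eq_left.2 h4, Real.volume_Ioo, ENNReal.ofReal_eq_zero] at h1
    have : x < u := hu
    linarith
  have hlim : Tendsto (fun y => f y - g y) (𝓝[>] x) (𝓝 (f x - g x)) :=
    ((hfr x hx).mono Set.Ioi_subset_Ici_self).tendsto.sub
      ((hgr x hx).mono Set.Ioi_subset_Ici_self).tendsto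
  exact sub_eq_zero.1 (isClosed_singleton.mem_of_frequently_of_tendsto hfreq hlim)

end LaplaceUniqueness

/-! ### Regularity and Laplace transforms of step functions. -/

section StepFunctions

/-- The right-continuous step function with values `u n` on `[h n, h (n + 1))`. -/
noncomputable def stepFunction (u : ℕ → ℝ) (h x : ℝ) : ℝ := u ⌊x / h⌋₊

variable {u : ℕ → ℝ} {h : ℝ}

lemma stepFunction_eq (hh : 0 < h) {n : ℕ} {x : ℝ} (h1 : h * n ≤ x) (h2 : x < h * (n + 1)) :
    stepFunction u h x = u n := by
  have h0 : 0 ≤ x := (mul_nonneg hh.le (Nat.cast_nonneg n)).trans h1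
  have : ⌊x / h⌋₊ = n := by
    rw [Nat.floor_eq_iff (div_nonneg h0 hh.le), le_div_iff₀ hh, div_lt_iff₀ hh]
    constructor <;> linarith
  rw [stepFunction, this]

lemma mul_floor_le (hh : 0 < h) {x : ℝ} (hx : 0 ≤ x) : h * (⌊x / h⌋₊ : ℝ) ≤ x := by
  have := Nat.floor_le (div_nonneg hx hh.le)
  rw [le_div_iff₀ hh] at this
  linarith

lemma lt_mul_floor_add_one (hh : 0 < h) (x : ℝ) : x < h * ((⌊x / h⌋₊ : ℝ) + 1) := by
  have := Nat.lt_floor_add_one (x / h)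
  rw [div_lt_iff₀ hh] at this
  linarith

lemma rightContinuous_stepFunction (hh : 0 < h) : RightContinuous (stepFunction u h) := by
  intro x hx
  refine (continuousWithinAt_const (b := stepFunction u h x)).congr_of_eventuallyEq ?_ rfl
  filter_upwards [Ico_mem_nhdsGE (lt_mul_floor_add_one hh x)] with y hy
  exact stepFunction_eq hh ((mul_floor_le hh hx).trans hy.1) hy.2

lemma piecewiseContinuous_stepFunction (hh : 0 < h) : PiecewiseContinuous (stepFunction u h) := by
  refine ⟨fun b => ?_, fun x hx => ?_, fun x hx => ?_⟩
  · refine ((Finset.range (⌊b / h⌋₊ + 1)).image fun k : ℕ => h * (k : ℝ)).finite_toSet.subset ?_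
    rintro x ⟨⟨hx0, hxb⟩, hx⟩
    simp only [Finset.coe_image, Set.mem_image, Finset.mem_coe, Finset.mem_range]
    refine ⟨⌊x / h⌋₊, Nat.lt_succ_of_le (Nat.floor_mono (by gcongr)), ?_⟩
    by_contra hne
    have hlt : h * (⌊x / h⌋₊ : ℝ) < x := lt_of_le_of_ne (mul_floor_le hh hx0) hne
    refine hx (ContinuousAt.continuousWithinAt ?_)
    refine (continuousAt_const (y := stepFunction u h x)).congr ?_
    filter_upwards [Ioo_mem_nhds hlt (lt_mul_floor_add_one hh x)] with y hy
    exact (stepFunction_eq hh hy.1.le hy.2).symm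
  · exact ⟨_, ((rightContinuous_stepFunction hh x hx).mono Set.Ioi_subset_Ici_self).tendsto⟩
  -- For the left limit the relevant cell is the one with `h * n < x ≤ h * (n + 1)`, so a lattice
  -- point belongs to the cell on its left.
  · set n := ⌈x / h⌉₊ - 1 with hn
    have hpos : 0 < ⌈x / h⌉₊ := Nat.ceil_pos.2 (div_pos hx hh)
    have h1 : h * (n : ℝ) < x := by
      have : n < ⌈x / h⌉₊ := by omega
      rw [Nat.lt_ceil, lt_div_iff₀ hh] at this
      linarith
    have h2 : x ≤ h * ((n : ℝ) + 1) := by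
      have h3 := Nat.le_ceil (x / h)
      have h4 : (⌈x / h⌉₊ : ℝ) = n + 1 := by
        rw [show ⌈x / h⌉₊ = n + 1 by omega]; push_cast; rfl
      rw [h4, div_le_iff₀ hh] at h3
      linarith
    refine ⟨u n, tendsto_const_nhds.congr' ?_⟩
    filter_upwards [Ioo_mem_nhdsLT h1] with y hy
    exact (stepFunction_eq hh hy.1.le (hy.2.trans_le h2)).symm

lemma exponentialOrder_stepFunction (hh : 0 < h) (hu : ∀ n, 0 ≤ u n) {C R : ℝ} (hR : 1 ≤ R)
    (hC : 0 ≤ C) (hle : ∀ n, u n ≤ C * R ^ n) : ExponentialOrder (stepFunction u h) := by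
  refine ⟨fun x _ => hu _, Real.log R / h, C, div_nonneg (Real.log_nonneg hR) hh.le, hC,
    fun x hx => (hle _).trans (mul_le_mul_of_nonneg_left ?_ hC)⟩
  rw [← Real.exp_log (zero_lt_one.trans_le hR), ← Real.exp_nat_mul, Real.exp_le_exp, Real.log_exp]
  calc (⌊x / h⌋₊ : ℝ) * Real.log R ≤ x / h * Real.log R :=
        mul_le_mul_of_nonneg_right (Nat.floor_le (div_nonneg hx hh.le)) (Real.log_nonneg hR)
    _ = _ := by ring

lemma iUnion_Ico_mul (hh : 0 < h) :
    (⋃ n : ℕ, Set.Ico (h * n) (h * ((n : ℝ) + 1))) = Set.Ici 0 := by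
  ext x
  simp only [Set.mem_iUnion, Set.mem_Ico, Set.mem_Ici]
  refine ⟨fun ⟨n, h1, _⟩ => (mul_nonneg hh.le (Nat.cast_nonneg n)).trans h1, fun hx =>
    ⟨⌊x / h⌋₊, mul_floor_le hh hx, lt_mul_floor_add_one hh x⟩⟩

lemma pairwise_disjoint_Ico_mul (hh : 0 < h) :
    Pairwise (Function.onFun Disjoint fun n : ℕ => Set.Ico (h * n) (h * ((n : ℝ) + 1))) := by
  intro i j hij
  refine Set.disjoint_left.2 fun x hi hj => hij ?_
  have key : ∀ {n : ℕ}, x ∈ Set.Ico (h * n) (h * ((n : ℝ) + 1)) → ⌊x / h⌋₊ = n := by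
    intro n hn
    have h0 : 0 ≤ x := (mul_nonneg hh.le (Nat.cast_nonneg n)).trans hn.1
    rw [Nat.floor_eq_iff (div_nonneg h0 hh.le), le_div_iff₀ hh, div_lt_iff₀ hh]
    constructor <;> linarith [hn.1, hn.2]
  rw [← key hi, ← key hj]

lemma setIntegral_Ico_exp {β : ℝ} (hβ : β ≠ 0) (n : ℕ) (hh : 0 < h) :
    ∫ x in Set.Ico (h * n) (h * ((n : ℝ) + 1)), Real.exp (-β * x) =
      (1 - Real.exp (-β * h)) / β * Real.exp (-β * h) ^ n := by
  rw [integral_Ico_eq_integral_Ioc, ← intervalIntegral.integral_of_le (by nlinarith),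
    intervalIntegral.integral_comp_mul_left (fun x => Real.exp x) (neg_ne_zero.2 hβ),
    integral_exp, smul_eq_mul, ← Real.exp_nat_mul]
  have e1 : -β * (h * ((n : ℝ) + 1)) = n * (-β * h) + -β * h := by ring
  have e2 : -β * (h * (n : ℝ)) = n * (-β * h) := by ring
  rw [e1, e2, Real.exp_add]
  field_simp
  ring

lemma integrableOn_and_integral_stepFunction (hh : 0 < h) (hu : ∀ n, 0 ≤ u n) {β : ℝ} (hβ : β ≠ 0)
    (hs : Summable fun n => u n * Real.exp (-β * h) ^ n) :
    IntegrableOn (fun x => Real.exp (-β * x) * stepFunction u h x) (Set.Ioi 0) ∧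
      ∫ x in Set.Ioi (0 : ℝ), Real.exp (-β * x) * stepFunction u h x =
        (1 - Real.exp (-β * h)) / β * ∑' n, u n * Real.exp (-β * h) ^ n := by
  have hcongr : ∀ n : ℕ, Set.EqOn (fun x => Real.exp (-β * x) * stepFunction u h x)
      (fun x => Real.exp (-β * x) * u n) (Set.Ico (h * n) (h * ((n : ℝ) + 1))) := fun n x hx => by
    simp only [stepFunction_eq hh hx.1 hx.2]
  have hint : ∀ n : ℕ, IntegrableOn (fun x => Real.exp (-β * x) * stepFunction u h x)
      (Set.Ico (h * n) (h * ((n : ℝ) + 1))) := fun n => by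
    rw [integrableOn_congr_fun (hcongr n) measurableSet_Ico]
    have hc : Continuous fun x => Real.exp (-β * x) * u n := by fun_prop
    exact (hc.integrableOn_Icc).mono_set Set.Ico_subset_Icc_self
  have hval : ∀ n : ℕ, ∫ x in Set.Ico (h * n) (h * ((n : ℝ) + 1)),
      Real.exp (-β * x) * stepFunction u h x =
      (1 - Real.exp (-β * h)) / β * (u n * Real.exp (-β * h) ^ n) := fun n => by
    rw [setIntegral_congr_fun measurableSet_Ico (hcongr n), integral_mul_const,
      setIntegral_Ico_exp hβ n hh]
    ring
  have hnn : ∀ x, 0 ≤ Real.exp (-β * x) * stepFunction u h x := fun x =>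
    mul_nonneg (Real.exp_pos _).le (hu _)
  have hsum : Summable fun n : ℕ => ∫ x in Set.Ico (h * n) (h * ((n : ℝ) + 1)),
      ‖Real.exp (-β * x) * stepFunction u h x‖ := by
    simp_rw [Real.norm_of_nonneg (hnn _), hval]
    exact hs.mul_left _
  have hI := integrableOn_iUnion_of_summable_integral_norm hint hsum
  have hS := hasSum_integral_iUnion (fun n => measurableSet_Ico) (pairwise_disjoint_Ico_mul hh) hI
  rw [iUnion_Ico_mul hh] at hI hS
  refine ⟨hI.mono_set Set.Ioi_subset_Ici_self, ?_⟩
  rw [← integral_Ici_eq_integral_Ioi, ← hS.tsum_eq, ← tsum_mul_left]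
  exact tsum_congr hval

end StepFunctions

/-! ### The Laplace exponent and the transform of the scale function. -/

section LaplaceExponent

variable {lam : Measure ℝ} {h : ℝ}

lemma IsSkipFreeMeasure.hasSum_laplaceExponent (H : IsSkipFreeMeasure lam h) {β : ℝ} (hβ : 0 ≤ β) :
    HasSum (fun i : ℕ => downMass lam h i * (Real.exp (-β * h) ^ i - 1))
      (laplaceExponent lam β - lam.real {h} * (1 / Real.exp (-β * h) - 1)) := by
  have := H.finite
  have hint : Integrable (fun x => Real.exp (β * x) - 1) lam := by
    refine Integrable.of_bound (Measurable.aestronglyMeasurable (by fun_prop))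
      (Real.exp (β * h)) ?_
    filter_upwards [H.ae_eq_of_pos] with x hx
    have hxh : x ≤ h := by
      rcases le_or_gt x 0 with h0 | h0
      · exact h0.trans H.h_pos.le
      · exact (hx h0).le
    have h1 : Real.exp (β * x) ≤ Real.exp (β * h) :=
      Real.exp_le_exp.2 (mul_le_mul_of_nonneg_left hxh hβ)
    have h2 := Real.exp_pos (β * x)
    have h3 : 1 ≤ Real.exp (β * h) := Real.one_le_exp (mul_nonneg hβ H.h_pos.le)
    rw [Real.norm_eq_abs, abs_le]
    constructor <;> linarith
  have h1 := H.hasSum_integral hint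
  have e1 : Real.exp (β * h) = 1 / Real.exp (-β * h) := by
    rw [one_div, ← Real.exp_neg]; congr 1; ring
  rw [e1] at h1
  refine h1.congr_fun fun i => ?_
  rw [← Real.exp_nat_mul]
  congr 3; ring

lemma IsSkipFreeMeasure.laplaceExponent_eq (H : IsSkipFreeMeasure lam h) {β : ℝ} (hβ : 0 ≤ β) :
    laplaceExponent lam β = lam.real {h} / Real.exp (-β * h) +
      ∑' i, downMass lam h i * Real.exp (-β * h) ^ i - lam.real Set.univ := by
  have h1 := (H.hasSum_laplaceExponent hβ).add H.isJumpData.hasSum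
  have h2 := (h1.congr_fun (g := fun i => downMass lam h i * Real.exp (-β * h) ^ i)
    fun i => by ring).tsum_eq
  rw [h2]; ring

/-- At a root `p e^{βh} ≤ c`. Boundedness is what makes the supremum `largestRoot` an upper bound of
the roots. -/
lemma IsSkipFreeMeasure.bddAbove_roots (H : IsSkipFreeMeasure lam h) :
    BddAbove {β : ℝ | 0 ≤ β ∧ laplaceExponent lam β = 0} := by
  have J := H.isJumpData
  refine ⟨Real.log (lam.real Set.univ / lam.real {h}) / h, ?_⟩
  rintro β ⟨hβ, h0⟩
  have h1 := H.laplaceExponent_eq hβ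
  have h2 : 0 ≤ ∑' i, downMass lam h i * Real.exp (-β * h) ^ i :=
    tsum_nonneg fun i => mul_nonneg (J.nonneg i) (pow_nonneg (Real.exp_pos _).le i)
  have h3 : lam.real {h} / Real.exp (-β * h) = lam.real {h} * Real.exp (β * h) := by
    rw [neg_mul, Real.exp_neg, div_inv_eq_mul]
  rw [h0, h3] at h1
  rw [le_div_iff₀ H.h_pos, Real.le_log_iff_exp_le (div_pos H.total_mass_pos J.pos),
    le_div_iff₀ J.pos]
  linarith

lemma IsSkipFreeMeasure.le_largestRoot (H : IsSkipFreeMeasure lam h) {β : ℝ} (hβ : 0 ≤ β)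
    (h0 : laplaceExponent lam β = 0) : β ≤ largestRoot lam :=
  le_csSup H.bddAbove_roots ⟨hβ, h0⟩

lemma IsSkipFreeMeasure.isScaleSolution (H : IsSkipFreeMeasure lam h)
    (hr : Monotone fun n => latticeScale lam h n / latticeScale lam h (n + 1)) :
    IsScaleSolution lam h
      (fun x => 1 / (h * lam.real {h}) * stepFunction (latticeScale lam h) h x) := by
  have J := H.isJumpData
  have hh := H.h_pos
  set p := lam.real {h} with hp
  have hp0 : 0 < p := J.pos
  set w := latticeScale lam h with hw
  have hwnn : ∀ n, 0 ≤ w n := fun n => (J.scaleSeq_pos n).le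
  obtain ⟨q, hq0, hq1, hlim, hq⟩ := J.exists_ratio_limit hr
  -- The limit equation for `q` says that `ψ` vanishes at the `β` with `e^{-βh} = q`. Thus `β >
  -- Φ(0)` forces `e^{-βh} < q`, inside the disc of convergence.
  have hroot : -Real.log q / h ≤ largestRoot lam := by
    have h0 : 0 ≤ -Real.log q / h :=
      div_nonneg (neg_nonneg.2 (Real.log_nonpos hq0.le hq1)) hh.le
    refine H.le_largestRoot h0 ?_
    have h1 : Real.exp (-(-Real.log q / h) * h) = q := by
      rw [neg_mul, div_mul_cancel₀ _ hh.ne', neg_neg, Real.exp_log hq0]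
    rw [H.laplaceExponent_eq h0, h1]
    linarith
  have hroot0 : 0 ≤ largestRoot lam :=
    (div_nonneg (neg_nonneg.2 (Real.log_nonpos hq0.le hq1)) hh.le).trans hroot
  have hsummable : ∀ β, largestRoot lam < β →
      Summable fun n => w n * Real.exp (-β * h) ^ n := by
    intro β hβ
    refine summable_scaleSeq_mul_pow J hq0 hlim (Real.exp_pos _) ?_
    rw [← Real.lt_log_iff_exp_lt hq0]
    have := hroot.trans_lt hβ
    rw [div_lt_iff₀ hh] at this
    linarith
  have hstep := fun β (hβ : largestRoot lam < β) =>
    integrableOn_and_integral_stepFunction hh hwnn (hroot0.trans_lt hβ).ne' (hsummable β hβ)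
  have hmul : ∀ β x : ℝ, Real.exp (-β * x) * (1 / (h * p) * stepFunction w h x) =
      1 / (h * p) * (Real.exp (-β * x) * stepFunction w h x) := fun β x => by ring
  have hscale : ∀ x, 1 / (h * p) * stepFunction w h x =
      stepFunction (fun n => 1 / (h * p) * w n) h x := fun x => rfl
  have hc : 0 < 1 / (h * p) := by positivity
  refine ⟨?_, ?_, ?_, fun β hβ => ?_, fun β hβ => ?_⟩
  · simp_rw [hscale]; exact rightContinuous_stepFunction hh
  · simp_rw [hscale]; exact piecewiseContinuous_stepFunction hh
  · simp_rw [hscale]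
    exact exponentialOrder_stepFunction hh (fun n => mul_nonneg hc.le (hwnn n))
      ((one_le_div hp0).2 J.le_total) hc.le
      (fun n => mul_le_mul_of_nonneg_left (J.scaleSeq_le_pow n) hc.le)
  · simp_rw [hmul]
    exact (hstep β hβ).1.const_mul _
  · simp_rw [hmul]
    rw [integral_const_mul, (hstep β hβ).2]
    have hβ0 : 0 < β := hroot0.trans_lt hβ
    have hz0 := Real.exp_pos (-β * h)
    have hz1 : Real.exp (-β * h) ≤ 1 := Real.exp_le_one_iff.2 (by nlinarith)
    have hG := J.tsum_scaleSeq hz0 hz1 (hsummable β hβ)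
    rw [← H.laplaceExponent_eq hβ0.le] at hG
    have e1 : Real.exp (β * h) = 1 / Real.exp (-β * h) := by
      rw [one_div, ← Real.exp_neg]; congr 1; ring
    rw [e1]
    -- The generating function times `ψ β` equals `p / z > 0`.
    have hψ : laplaceExponent lam β ≠ 0 := by
      intro h0
      rw [h0, mul_zero] at hG
      exact (div_pos hp0 hz0).ne hG
    have hG' := (eq_div_iff hψ).2 hG
    change 1 / (h * p) * ((1 - Real.exp (-β * h)) / β *
      ∑' n, scaleSeq (downMass lam h) p (lam.real Set.univ) n * Real.exp (-β * h) ^ n) = _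
    rw [hG']
    have := hz0.ne'
    have := hβ0.ne'
    have := hp0.ne'
    field_simp

lemma IsScaleSolution.eq {f g : ℝ → ℝ} (hf : IsScaleSolution lam h f)
    (hg : IsScaleSolution lam h g) {x : ℝ} (hx : 0 ≤ x) : f x = g x :=
  eq_of_laplace_eq hf.exponentialOrder.1 hg.exponentialOrder.1 hf.rightContinuous
    hg.rightContinuous hf.integrable hg.integrable
    (fun β hβ => (hf.laplace β hβ).trans (hg.laplace β hβ).symm) hx

end LaplaceExponent

end SkipFree

/-! ### The theorem. -/

theorem mainTheorem1 {Ω : Type*} [MeasurableSpace Ω] (P : Measure Ω) [IsProbabilityMeasure P]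
    (X : ℝ≥0 → Ω → ℝ) (lam : Measure ℝ) (h : ℝ) (hX : SkipFree.IsUpwardsSkipFree P X lam h) :
    -- the probabilities that define `W` are probabilities of measurable events, and positive
    (∀ r : ℕ, 1 ≤ r →
      NullMeasurableSet
        {ω | SkipFree.excursionDepth X h 1 ω ≤ ((((r : ℝ) - 1) * h : ℝ) : EReal)} P ∧
      0 < P.real
        {ω | SkipFree.excursionDepth X h 1 ω ≤ ((((r : ℝ) - 1) * h : ℝ) : EReal)}) ∧
    -- the two-sided exit probability
    (∀ y ∈ SkipFree.lattice h, 0 ≤ y → ∀ x : ℝ, 0 ≤ x →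
      NullMeasurableSet
        {ω | ((-x : ℝ) : EReal) ≤ SkipFree.runningInf X (SkipFree.entranceTime X y ω) ω} P ∧
      P.real {ω | ((-x : ℝ) : EReal) ≤
          SkipFree.runningInf X (SkipFree.entranceTime X y ω) ω} =
        SkipFree.scaleFunction P X h x / SkipFree.scaleFunction P X h (x + y)) ∧
    -- the Laplace transform of `W`, up to a multiplicative constant, and uniqueness
    (∃ c : ℝ, 0 < c ∧
      SkipFree.IsScaleSolution lam h (fun x => c * SkipFree.scaleFunction P X h x) ∧
      ∀ V : ℝ → ℝ, SkipFree.IsScaleSolution lam h V →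
        ∀ x : ℝ, 0 ≤ x → V x = c * SkipFree.scaleFunction P X h x) := by
  have H := hX.isSkipFreeMeasure
  have J := H.isJumpData
  have hh := hX.h_pos
  refine ⟨fun r hr => ?_, fun y hy hy0 x hx => ?_, ?_⟩
  · obtain ⟨n, rfl⟩ := Nat.exists_eq_add_of_le' hr
    have h1 : (((n + 1 : ℕ) : ℝ) - 1) * h = n * h := by push_cast; ring
    rw [h1]
    refine ⟨SkipFree.nullMeasurableSet_excursionDepth hX n, ?_⟩
    rw [SkipFree.excursionDepth_probability hX n]
    exact div_pos (J.scaleSeq_pos _) (J.scaleSeq_pos _)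
  · obtain ⟨k, rfl⟩ := hy
    dsimp only at hy0 ⊢
    have hk : 0 ≤ k := by
      have : (0 : ℝ) ≤ k := nonneg_of_mul_nonneg_right hy0 hh
      exact_mod_cast this
    obtain ⟨m, rfl⟩ := Int.eq_ofNat_of_zero_le hk
    rw [Int.cast_natCast]
    have hae := SkipFree.le_runningInf_ae_eq hX hx m
    obtain ⟨h1, h2⟩ := SkipFree.nullMeasurableSet_exitsUp_and_probability hX
      (Nat.le_add_right ⌊x / h⌋₊ m)
    refine ⟨h1.congr hae.symm, ?_⟩
    have h3 : ⌊(x + h * m) / h⌋₊ = ⌊x / h⌋₊ + m := by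
      rw [add_div, mul_div_cancel_left₀ _ hh.ne', Nat.floor_add_natCast (div_nonneg hx hh.le)]
    rw [measureReal_congr hae, h2, SkipFree.scaleFunction_eq hX, SkipFree.scaleFunction_eq hX, h3]
  · have hsol := H.isScaleSolution (SkipFree.monotone_latticeScale_ratio hX)
    -- The transform of `W` itself is `p (e^{βh} - 1) / (β ψ(β))`, so the normalization is `1 / (h
    -- p)`.
    refine ⟨1 / (h * lam.real {h}), div_pos one_pos (mul_pos hh J.pos), ?_, fun V hV x hx => ?_⟩
    · simp_rw [SkipFree.scaleFunction_eq hX]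
      exact hsol
    · rw [SkipFree.scaleFunction_eq hX]
      exact hV.eq hsol hx
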